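/- All rings are commutative and Noetherian, and "finite module" means finitely generated module. A finite module $N$ over a local ring $R$ is called maximal Cohen-Macaulay (MCM) if $\operatorname{depth} N = \dim R$; since $\operatorname{depth} 0 = +\infty$, the zero module is not MCM. For a finite $R$-module $M$, let $\Omega_0^R M = M$ and, for $s \ge 1$, let $\Omega_s^R M$ be the image of the $s$-th differential $F_s \to F_{s-1}$ in a minimal free resolution $\cdots \to F_1 \to F_0 \to M \to 0$ of $M$. **Corollary.** Let $R$ be a Cohen-Macaulay local ring possessing a canonical module $\omega_R$, and write $X^\vee = \operatorname{Hom}_R(X, \omega_R)$. Let $M$ and $N$ be finite $R$-modules with $N$ maximal Cohen-Macaulay, and let $n \ge 1$ be an integer. Assume that, for each $j = 0, \ldots, n-1$, the $R$-module $\operatorname{Tor}_j^R(M, N^\vee)$ is either zero or maximal Cohen-Macaulay. Then the following assertions hold. (i) Suppose $\operatorname{Tor}_n^R(M, N^\vee) = 0$. Then $\operatorname{Ext}^n_R(M, N) = 0$ and $$\operatorname{Ext}^{n+1}_R(M, N) \cong \operatorname{Tor}_{n+1}^R(M, N^\vee)^\vee.$$ (ii) Suppose $\operatorname{Tor}_n^R(M,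 N^\vee) \ne 0$. If both $\Omega_{n-1}^R M \otimes_R N^\vee$ and $\Omega_n^R M \otimes_R N^\vee$ are maximal Cohen-Macaulay, then $\operatorname{Tor}_n^R(M, N^\vee)$ is maximal Cohen-Macaulay as well, and $$\operatorname{Ext}^j_R(M, N) \cong \operatorname{Tor}_j^R(M, N^\vee)^\vee \quad \text{for all } j = 0, \ldots, n+1.$$ In particular, $\operatorname{Ext}^n_R(M, N) \ne 0$. -/

import Mathlib

open CategoryTheory IsLocalRing
open scoped TensorProduct

universe u

noncomputable section

/-- The depth of a module over a local ring: the supremum of the lengths of the sequences of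
elements of the maximal ideal that are weakly regular on `M`. For a nonzero finite module
over a Noetherian local ring, such sequences are exactly the regular ones, by Nakayama's lemma.
For `M = 0` every sequence is weakly regular, so that `depth 0 = ∞`. -/
def moduleDepth (R : Type u) [CommRing R] [IsLocalRing R]
    (M : Type u) [AddCommGroup M] [Module R M] : ℕ∞ :=
  ⨆ (rs : List R) (_ : ∀ r ∈ rs, r ∈ maximalIdeal R)
    (_ : RingTheory.Sequence.IsWeaklyRegular M rs), (rs.length : ℕ∞)

/-- Maximal Cohen-Macaulay modules: finite modules with `depth M = dim R`. Over a Noetherian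
local ring the zero module is not maximal Cohen-Macaulay, as its depth is infinite. -/
structure IsMCM (R : Type u) [CommRing R] [IsLocalRing R]
    (M : Type u) [AddCommGroup M] [Module R M] : Prop where
  finite : Module.Finite R M
  depth_eq : ((moduleDepth R M : ℕ∞) : WithBot ℕ∞) = ringKrullDim R

/-- Cohen-Macaulay local rings: Noetherian local rings with `depth R = dim R`. -/
structure IsCMLocalRing (R : Type u) [CommRing R] [IsLocalRing R] : Prop where
  noetherian : IsNoetherianRing R
  depth_eq : ((moduleDepth R R : ℕ∞) : WithBot ℕ∞) = ringKrullDim R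

/-- Canonical modules of a Cohen-Macaulay local ring `R` with residue field `k`: the maximal
Cohen-Macaulay modules `ω` of finite injective dimension and of type one. Here the type of `ω`
is the dimension over `k` of `Ext^d(k, ω)` with `d = depth ω = dim R`; it is one if and only if
this module, which is killed by the maximal ideal, is isomorphic to `k`. -/
structure IsCanonicalModule (R : Type u) [CommRing R] [IsLocalRing R]
    (ω : Type u) [AddCommGroup ω] [Module R ω] : Prop where
  isMCM : IsMCM R ω
  finite_injectiveDimension :
    ∃ m : ℕ, HasInjectiveDimensionLE (ModuleCat.of R ω) m
  type_eq_one : ∃ d : ℕ, ringKrullDim R = d ∧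
    Nonempty (Abelian.Ext.{u} (ModuleCat.of R (ResidueField R)) (ModuleCat.of R ω) d
      ≃ₗ[R] ResidueField R)

/-- The module `Ext^j_R(M, N)`. -/
abbrev ExtMod (R : Type u) [CommRing R] (j : ℕ) (M N : Type u)
    [AddCommGroup M] [Module R M] [AddCommGroup N] [Module R N] : Type u :=
  Abelian.Ext.{u} (ModuleCat.of R M) (ModuleCat.of R N) j

/-- The module `Tor_j^R(M, N)`: the `j`-th left derived functor of `- ⊗ N`, applied to `M`. -/
abbrev TorMod (R : Type u) [CommRing R] (j : ℕ) (M N : Type u)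
    [AddCommGroup M] [Module R M] [AddCommGroup N] [Module R N] : Type u :=
  (((Tor' (ModuleCat.{u} R) j).obj (ModuleCat.of R M)).obj (ModuleCat.of R N) : ModuleCat.{u} R)

/-- A projective resolution `⋯ → F₁ → F₀ → M → 0` over a local ring is a minimal free resolution
(by finite modules) if each `Fᵢ` is finite free and each differential has image in `𝔪 Fᵢ`. -/
structure IsMinimalFreeResolution {R : Type u} [CommRing R] [IsLocalRing R]
    {M : ModuleCat.{u} R} (F : ProjectiveResolution M) : Prop where
  free : ∀ i, Module.Free R (F.complex.X i)
  finite : ∀ i, Module.Finite R (F.complex.X i)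
  minimal : ∀ i, LinearMap.range (F.complex.d (i + 1) i).hom ≤
    maximalIdeal R • (⊤ : Submodule R (F.complex.X i))

/-- The syzygies read off a resolution `F` of `M`: `Ω₀ = M`, and `Ω_s` is the image of the `s`-th
differential `F_s → F_{s-1}` for `s ≥ 1`. -/
def syzygy {R : Type u} [CommRing R] {M : ModuleCat.{u} R} (F : ProjectiveResolution M) :
    ℕ → ModuleCat.{u} R
  | 0 => M
  | s + 1 => ModuleCat.of R (LinearMap.range (F.complex.d (s + 1) s).hom)

end

/-! Put B = N^∨ and d = dim R, and call X acyclic if Ext^i(X, ω) = 0 for all i > 0. Finite modules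
of depth at least d are acyclic and ω-reflexive, and their duals again have depth at least d. So for
a projective resolution F of M there is an isomorphism Hom(F, N) ≅ Hom(F ⊗ B, ω), and Ext^n(M, N) is
the cohomology of the dual of a complex of acyclic modules whose homology is Tor_j(M, B). If Tor_j
is acyclic for j < n, then so are the boundaries and the cokernels of the differentials below degree
n, and dualizing commutes with homology in degree n (`nonempty_ext_equiv`). In (i), Tor_n = 0 is
acyclic, which gains one more degree. In (ii), the depth lemma makes Tor_n maximal Cohen-Macaulay
(`isMCM_torMod`); this again gains a degree, and Ext^n ≠ 0 because Tor_n embeds in its bidual.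

The properties of ω are derived from its definition. Finite injective dimension is sharpened to d on
finite modules (`ext_vanishing_of_finite_injectiveDimension`), and a regular sequence of length d on
X then brings the vanishing down to all positive degrees. For biduality, ω is divided by a regular
sequence of length d until Ext^d(-, ω) turns into Hom(-, ω/(x)ω). That functor is exact on finite
modules killed by the sequence, and type one makes k self-dual, so dévissage applies; Nakayama lifts
the result back (`LinearMap.bijective_of_flip_bijective`). -/

/-! ### Long exact sequences of Ext -/

section ExtSequences

open Abelian

variable {R : Type u} [CommRing R] {A B C L W : Type u}
  [AddCommGroup A] [Module R A] [AddCommGroup B] [Module R B] [AddCommGroup C] [Module R C]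
  [AddCommGroup L] [Module R L] [AddCommGroup W] [Module R W]

theorem LinearMap.shortExact_ofExact {f : A →ₗ[R] B} {g : B →ₗ[R] C}
    (hf : Function.Injective f) (hg : Function.Surjective g) (h : Function.Exact f g) :
    (ModuleCat.shortComplexOfCompEqZero f g h.linearMap_comp_eq_zero).ShortExact :=
  ModuleCat.shortComplex_shortExact _ h hf hg

theorem ExtMod.subsingleton_congr (e : A ≃ₗ[R] B) (i : ℕ) :
    Subsingleton (ExtMod R i A W) ↔ Subsingleton (ExtMod R i B W) := by
  have key {A B : Type u} [AddCommGroup A] [Module R A] [AddCommGroup B] [Module R B]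
      (e : A ≃ₗ[R] B) (h : Subsingleton (ExtMod R i A W)) : Subsingleton (ExtMod R i B W) := by
    refine subsingleton_of_forall_eq 0 fun x ↦ ?_
    have h1 : (Ext.mk₀ (ModuleCat.ofHom e.symm.toLinearMap)).comp
        ((Ext.mk₀ (ModuleCat.ofHom e.toLinearMap)).comp x (zero_add i)) (zero_add i) = x := by
      rw [Ext.mk₀_comp_mk₀_assoc, ← ModuleCat.ofHom_comp]
      simp
    rw [← h1, Subsingleton.elim (Ext.comp _ x _) 0, Ext.comp_zero]
  exact ⟨key e, key e.symm⟩

theorem ExtMod.subsingleton_congr_right (e : A ≃ₗ[R] B) (i : ℕ) :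
    Subsingleton (ExtMod R i L A) ↔ Subsingleton (ExtMod R i L B) := by
  have key {A B : Type u} [AddCommGroup A] [Module R A] [AddCommGroup B] [Module R B]
      (e : A ≃ₗ[R] B) (h : Subsingleton (ExtMod R i L A)) : Subsingleton (ExtMod R i L B) := by
    refine subsingleton_of_forall_eq 0 fun x ↦ ?_
    have h1 : (x.comp (Ext.mk₀ (ModuleCat.ofHom e.symm.toLinearMap)) (add_zero i)).comp
        (Ext.mk₀ (ModuleCat.ofHom e.toLinearMap)) (add_zero i) = x := by
      rw [Ext.comp_assoc_of_third_deg_zero, Ext.mk₀_comp_mk₀, ← ModuleCat.ofHom_comp]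
      simp
    rw [← h1, Subsingleton.elim (Ext.comp x _ _) 0, Ext.zero_comp]
  exact ⟨key e, key e.symm⟩

theorem ExtMod.subsingleton_of_projective [Module.Projective R A] (i : ℕ) :
    Subsingleton (ExtMod R (i + 1) A W) :=
  have : Projective (ModuleCat.of R A) := (IsProjective.iff_projective A).mp inferInstance
  Ext.subsingleton_of_projective _ _ i

theorem ExtMod.subsingleton_of_subsingleton [h : Subsingleton A] (i : ℕ) :
    Subsingleton (ExtMod R i A W) := by
  refine subsingleton_of_forall_eq 0 fun x ↦ ?_
  have : 𝟙 (ModuleCat.of R A) = 0 := by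
    ext a
    exact h.elim _ _
  rw [← Ext.mk₀_id_comp x, this, Ext.mk₀_zero, Ext.zero_comp]

/-- The identification of `Ext^0(A, W)` with `Hom(A, W)`. -/
noncomputable def ExtMod.zeroEquiv : ExtMod R 0 A W ≃ₗ[R] (A →ₗ[R] W) :=
  Ext.linearEquiv₀.trans ModuleCat.homLinearEquiv

section Contravariant

variable {f : A →ₗ[R] B} {g : B →ₗ[R] C}

theorem ExtMod.subsingleton_mid (hf : Function.Injective f) (hg : Function.Surjective g)
    (h : Function.Exact f g) {i : ℕ} (hA : Subsingleton (ExtMod R i A W))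
    (hC : Subsingleton (ExtMod R i C W)) : Subsingleton (ExtMod R i B W) := by
  refine subsingleton_of_forall_eq 0 fun x ↦ ?_
  obtain ⟨y, rfl⟩ := Ext.contravariant_sequence_exact₂ (LinearMap.shortExact_ofExact hf hg h) (ModuleCat.of R W) x
    (Subsingleton.elim (α := ExtMod R i A W) _ _)
  rw [Subsingleton.elim (α := ExtMod R i C W) y 0, Ext.comp_zero]

theorem ExtMod.subsingleton_left (hf : Function.Injective f) (hg : Function.Surjective g)
    (h : Function.Exact f g) {i : ℕ} (hB : Subsingleton (ExtMod R i B W))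
    (hC : Subsingleton (ExtMod R (i + 1) C W)) : Subsingleton (ExtMod R i A W) := by
  refine subsingleton_of_forall_eq 0 fun x ↦ ?_
  obtain ⟨y, rfl⟩ := Ext.contravariant_sequence_exact₁ (LinearMap.shortExact_ofExact hf hg h) (ModuleCat.of R W) x
    (add_comm 1 i) (Subsingleton.elim (α := ExtMod R (i + 1) C W) _ _)
  rw [Subsingleton.elim (α := ExtMod R i B W) y 0, Ext.comp_zero]

theorem ExtMod.subsingleton_right (hf : Function.Injective f) (hg : Function.Surjective g)
    (h : Function.Exact f g) {i : ℕ} (hA : Subsingleton (ExtMod R i A W))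
    (hB : Subsingleton (ExtMod R (i + 1) B W)) : Subsingleton (ExtMod R (i + 1) C W) := by
  refine subsingleton_of_forall_eq 0 fun x ↦ ?_
  obtain ⟨y, rfl⟩ := Ext.contravariant_sequence_exact₃ (LinearMap.shortExact_ofExact hf hg h) (ModuleCat.of R W) x
    (Subsingleton.elim (α := ExtMod R (i + 1) B W) _ _) (add_comm 1 i)
  rw [Subsingleton.elim (α := ExtMod R i A W) y 0, Ext.comp_zero]

theorem ExtMod.exists_extension (hf : Function.Injective f) (hg : Function.Surjective g)
    (h : Function.Exact f g) (hC : Subsingleton (ExtMod R 1 C W)) (φ : A →ₗ[R] W) :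
    ∃ ψ : B →ₗ[R] W, ψ ∘ₗ f = φ := by
  obtain ⟨y, hy⟩ := Ext.contravariant_sequence_exact₁ (LinearMap.shortExact_ofExact hf hg h)
    (ModuleCat.of R W) (Ext.mk₀ (ModuleCat.ofHom φ)) (add_zero 1)
    (Subsingleton.elim (α := ExtMod R 1 C W) _ _)
  obtain ⟨ψ, rfl⟩ := (Ext.mk₀_bijective _ _).2 y
  rw [Ext.mk₀_comp_mk₀] at hy
  exact ⟨ψ.hom, congr_arg ModuleCat.Hom.hom ((Ext.mk₀_bijective _ _).1 hy)⟩

end Contravariant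

section Covariant

variable {f : A →ₗ[R] B} {g : B →ₗ[R] C}

theorem ExtMod.subsingleton_left' (hf : Function.Injective f) (hg : Function.Surjective g)
    (h : Function.Exact f g) {i : ℕ} (hC : Subsingleton (ExtMod R i L C))
    (hB : Subsingleton (ExtMod R (i + 1) L B)) : Subsingleton (ExtMod R (i + 1) L A) := by
  refine subsingleton_of_forall_eq 0 fun x ↦ ?_
  obtain ⟨y, rfl⟩ := Ext.covariant_sequence_exact₁ _ (LinearMap.shortExact_ofExact hf hg h) x
    (Subsingleton.elim (α := ExtMod R (i + 1) L B) _ _) rfl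
  rw [Subsingleton.elim (α := ExtMod R i L C) y 0, Ext.zero_comp]

theorem ExtMod.subsingleton_right' (hf : Function.Injective f) (hg : Function.Surjective g)
    (h : Function.Exact f g) {i : ℕ} (hB : Subsingleton (ExtMod R i L B))
    (hA : Subsingleton (ExtMod R (i + 1) L A)) : Subsingleton (ExtMod R i L C) := by
  refine subsingleton_of_forall_eq 0 fun x ↦ ?_
  obtain ⟨y, rfl⟩ := Ext.covariant_sequence_exact₃ _ (LinearMap.shortExact_ofExact hf hg h) x
    rfl (Subsingleton.elim (α := ExtMod R (i + 1) L A) _ _)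
  rw [Subsingleton.elim (α := ExtMod R i L B) y 0, Ext.zero_comp]

theorem ExtMod.exists_lift (hf : Function.Injective f) (hg : Function.Surjective g)
    (h : Function.Exact f g) (hA : Subsingleton (ExtMod R 1 L A)) (φ : L →ₗ[R] C) :
    ∃ ψ : L →ₗ[R] B, g ∘ₗ ψ = φ := by
  obtain ⟨y, hy⟩ := Ext.covariant_sequence_exact₃ (ModuleCat.of R L)
    (LinearMap.shortExact_ofExact hf hg h) (Ext.mk₀ (ModuleCat.ofHom φ)) (zero_add 1)
    (Subsingleton.elim (α := ExtMod R 1 L A) _ _)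
  obtain ⟨ψ, rfl⟩ := (Ext.mk₀_bijective _ _).2 y
  rw [Ext.mk₀_comp_mk₀] at hy
  exact ⟨ψ.hom, congr_arg ModuleCat.Hom.hom ((Ext.mk₀_bijective _ _).1 hy)⟩

theorem ExtMod.subsingleton_zero_left (hf : Function.Injective f)
    (hB : Subsingleton (ExtMod R 0 L B)) : Subsingleton (ExtMod R 0 L A) := by
  have hB' : Subsingleton (L →ₗ[R] B) :=
    (ExtMod.zeroEquiv (R := R)).symm.subsingleton
  have : Subsingleton (L →ₗ[R] A) :=
    ⟨fun φ ψ ↦ (LinearMap.cancel_left hf).mp (hB'.elim _ _)⟩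
  exact (ExtMod.zeroEquiv (R := R)).subsingleton

end Covariant

end ExtSequences

/-! ### Division by a regular element -/

section QuotSMulTop

open Pointwise

variable {R : Type u} [CommRing R] {L X W : Type u}
  [AddCommGroup L] [Module R L] [AddCommGroup X] [Module R X] [AddCommGroup W] [Module R W]

theorem QuotSMulTop.exact_lsmul_mkQ (x : R) :
    Function.Exact (LinearMap.lsmul R X x) (x • (⊤ : Submodule R X)).mkQ :=
  LinearMap.exact_lsmul_mkQ_smul_top X x

theorem QuotSMulTop.mkQ_surjective (x : R) :
    Function.Surjective (x • (⊤ : Submodule R X)).mkQ :=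
  Submodule.mkQ_surjective _

theorem QuotSMulTop.exists_smul_of_mkQ_eq_zero {x : R} {a : X}
    (h : (x • (⊤ : Submodule R X)).mkQ a = 0) : ∃ b, x • b = a :=
  (QuotSMulTop.exact_lsmul_mkQ x a).mp h

theorem ExtMod.smul_surjective {x : R} (hx : IsSMulRegular X x) {i : ℕ}
    (h : Subsingleton (ExtMod R (i + 1) (QuotSMulTop x X) W)) (z : ExtMod R i X W) :
    ∃ y : ExtMod R i X W, x • y = z := by
  obtain ⟨y, hy⟩ := Abelian.Ext.contravariant_sequence_exact₁
    (LinearMap.shortExact_ofExact (f := LinearMap.lsmul R X x) hx (QuotSMulTop.mkQ_surjective x)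
      (QuotSMulTop.exact_lsmul_mkQ x)) (ModuleCat.of R W) z (add_comm 1 i)
    (Subsingleton.elim (α := ExtMod R (i + 1) (QuotSMulTop x X) W) _ _)
  refine ⟨y, hy ▸ ?_⟩
  have : x • y = (Abelian.Ext.mk₀ (x • 𝟙 (ModuleCat.of R X))).comp y (zero_add i) := by
    rw [Abelian.Ext.mk₀_smul, Abelian.Ext.smul_comp, Abelian.Ext.mk₀_id_comp]
  exact this

/-- By the long exact sequence `x` acts surjectively on the finite module Ext^i(X, W), which is
therefore zero by Nakayama. -/
theorem ExtMod.subsingleton_of_quotSMulTop [IsLocalRing R] [IsNoetherianRing R]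
    [Module.Finite R X] [Module.Finite R W] {x : R} (hx : IsSMulRegular X x)
    (hm : x ∈ maximalIdeal R) {i : ℕ}
    (h : Subsingleton (ExtMod R (i + 1) (QuotSMulTop x X) W)) :
    Subsingleton (ExtMod R i X W) := by
  have : (⊤ : Submodule R (ExtMod R i X W)) ≤ maximalIdeal R • ⊤ := by
    intro z _
    obtain ⟨y, rfl⟩ := ExtMod.smul_surjective hx h z
    exact Submodule.smul_mem_smul hm trivial
  have := Submodule.eq_bot_of_le_smul_of_le_jacobson_bot (maximalIdeal R) ⊤
    Module.Finite.fg_top this (maximalIdeal_le_jacobson _)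
  exact (Submodule.subsingleton_iff R).mp (subsingleton_of_bot_eq_top this.symm)

end QuotSMulTop

open RingTheory.Sequence in
theorem RingTheory.Sequence.IsWeaklyRegular.of_subsingleton {R X : Type*} [CommRing R]
    [AddCommGroup X] [Module R X] [Subsingleton X] (rs : List R) :
    IsWeaklyRegular X rs := by
  induction rs generalizing X with
  | nil => exact IsWeaklyRegular.nil R X
  | cons r rs ih =>
    exact IsWeaklyRegular.cons (fun a b _ ↦ Subsingleton.elim a b) ih

/-! ### Depth, regular sequences and Ext from the residue field -/

section Depth

open Pointwise RingTheory.Sequence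

variable {R : Type u} [CommRing R] [IsLocalRing R] {X Y Z : Type u}
  [AddCommGroup X] [Module R X] [AddCommGroup Y] [Module R Y] [AddCommGroup Z] [Module R Z]

theorem natCast_le_moduleDepth_iff {n : ℕ} : (n : ℕ∞) ≤ moduleDepth R X ↔
    ∃ rs : List R, rs.length = n ∧ (∀ r ∈ rs, r ∈ maximalIdeal R) ∧ IsWeaklyRegular X rs := by
  constructor
  · intro h
    have : ∃ rs : List R, n ≤ rs.length ∧ (∀ r ∈ rs, r ∈ maximalIdeal R) ∧
        IsWeaklyRegular X rs := by
      by_contra! hlt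
      cases n with
      | zero => exact hlt [] le_rfl (by simp) (IsWeaklyRegular.nil R X)
      | succ n =>
        have : moduleDepth R X ≤ n := iSup_le fun rs ↦ iSup_le fun hm ↦ iSup_le fun hr ↦ by
          by_contra! hn
          exact hlt rs (by exact_mod_cast Order.add_one_le_of_lt hn) hm hr
        exact absurd (h.trans this) (by exact_mod_cast Nat.not_succ_le_self n)
    obtain ⟨rs, hn, hm, hr⟩ := this
    refine ⟨rs.take n, by simpa, fun r hr ↦ hm r (List.mem_of_mem_take hr), ?_⟩
    rw [← List.take_append_drop n rs, isWeaklyRegular_append_iff] at hr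
    exact hr.1
  · rintro ⟨rs, rfl, hm, hr⟩
    exact le_iSup_of_le rs (le_iSup_of_le hm (le_iSup_of_le hr le_rfl))

theorem support_residueField :
    Module.support R (ResidueField R) = PrimeSpectrum.zeroLocus (maximalIdeal R : Set R) := by
  rw [Module.support_eq_zeroLocus]
  exact congr_arg (fun I : Ideal R ↦ PrimeSpectrum.zeroLocus (I : Set R)) Ideal.annihilator_quotient

/-- Rees's characterization of depth. Weak regularity lets it include the zero module, for which
both sides hold. -/
theorem exists_isWeaklyRegular_iff_ext [IsNoetherianRing R] [Module.Finite R X] {n : ℕ} :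
    (∃ rs : List R, rs.length = n ∧ (∀ r ∈ rs, r ∈ maximalIdeal R) ∧ IsWeaklyRegular X rs) ↔
      ∀ i < n, Subsingleton (ExtMod R i (ResidueField R) X) := by
  rcases subsingleton_or_nontrivial X with hX | hX
  · refine iff_of_true ⟨List.replicate n 0, by simp, fun r hr ↦ ?_, .of_subsingleton _⟩
      fun i _ ↦ ?_
    · rw [List.eq_of_mem_replicate hr]
      exact zero_mem _
    · refine subsingleton_of_forall_eq 0 fun x ↦ ?_
      have : 𝟙 (ModuleCat.of R X) = 0 := by
        ext a
        exact hX.elim _ _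
      rw [← Abelian.Ext.comp_mk₀_id x, this, Abelian.Ext.mk₀_zero, Abelian.Ext.comp_zero]
  · have hlt : maximalIdeal R • (⊤ : Submodule R X) < ⊤ :=
      (Submodule.top_ne_ideal_smul_of_le_jacobson_annihilator
        (maximalIdeal_le_jacobson _)).symm.lt_top
    have : Module.Finite R (ResidueField R) := inferInstance
    constructor
    · rintro ⟨rs, rfl, hm, hr⟩
      exact ModuleCat.subsingleton_ext_of_exists_isRegular (maximalIdeal R)
        (ModuleCat.of R (ResidueField R)) support_residueField.subset (ModuleCat.of R X) hlt rs hm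
        (.of_isWeaklyRegular_of_mem_maximalIdeal X hm hr)
    · intro h
      obtain ⟨rs, hl, hm, hr⟩ := ModuleCat.exists_isRegular_of_exists_subsingleton_ext
        (maximalIdeal R) n (ModuleCat.of R X) hlt (ModuleCat.of R (ResidueField R))
        support_residueField h
      exact ⟨rs, hl, hm, hr.1⟩

theorem length_le_ringKrullDim [IsNoetherianRing R] [Module.Finite R X] [Nontrivial X]
    {rs : List R} (hm : ∀ r ∈ rs, r ∈ maximalIdeal R) (hr : IsWeaklyRegular X rs) :
    (rs.length : WithBot ℕ∞) ≤ ringKrullDim R := by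
  have hreg := IsRegular.of_isWeaklyRegular_of_mem_maximalIdeal X hm hr
  have : Nontrivial (X ⧸ Ideal.ofList rs • (⊤ : Submodule R X)) :=
    hreg.quot_ofList_smul_nontrivial _
  refine le_trans ?_ (Module.supportDim_le_ringKrullDim R X)
  rw [← Module.supportDim_add_length_eq_supportDim_of_isRegular rs hreg]
  have h0 := (Module.supportDim_ne_bot_iff_nontrivial R
    (X ⧸ Ideal.ofList rs • (⊤ : Submodule R X))).mpr this
  obtain ⟨a, ha⟩ := WithBot.ne_bot_iff_exists.mp h0
  rw [← ha]
  exact_mod_cast le_add_self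

/-- For a nonzero finite module depth never exceeds dim R, so only the lower bound is a condition.
-/
theorem isMCM_iff [IsNoetherianRing R] [Module.Finite R X] {d : ℕ} (hd : ringKrullDim R = d) :
    IsMCM R X ↔ Nontrivial X ∧ ∀ i < d, Subsingleton (ExtMod R i (ResidueField R) X) := by
  rw [← exists_isWeaklyRegular_iff_ext, ← natCast_le_moduleDepth_iff]
  constructor
  · intro h
    have hX : moduleDepth R X = d := by exact_mod_cast h.depth_eq.trans hd
    refine ⟨?_, hX.ge⟩
    by_contra hn
    rw [not_nontrivial_iff_subsingleton] at hn
    -- On the zero module a list of `d + 1` zeros is weakly regular, so the depth would exceed `d`.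
    have : ((d + 1 : ℕ) : ℕ∞) ≤ moduleDepth R X := natCast_le_moduleDepth_iff.mpr
      ⟨List.replicate (d + 1) 0, by simp, fun r hr ↦ by
        rw [List.eq_of_mem_replicate hr]; exact zero_mem _, .of_subsingleton _⟩
    rw [hX] at this
    exact absurd this (by exact_mod_cast Nat.not_succ_le_self d)
  · rintro ⟨_, h⟩
    refine ⟨inferInstance, ?_⟩
    rw [hd]
    refine le_antisymm ?_ (by exact_mod_cast h)
    have : moduleDepth R X ≤ d := iSup_le fun rs ↦ iSup_le fun hm ↦ iSup_le fun hr ↦ by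
      have := (length_le_ringKrullDim hm hr).trans_eq hd
      exact_mod_cast this
    exact_mod_cast this

/-- Modules whose depth is at least `n` have a common weakly regular sequence of length `n`. -/
theorem exists_common_isWeaklyRegular [IsNoetherianRing R] [Module.Finite R X] [Module.Finite R Y]
    [Module.Finite R Z] {n : ℕ}
    (hX : ∀ i < n, Subsingleton (ExtMod R i (ResidueField R) X))
    (hY : ∀ i < n, Subsingleton (ExtMod R i (ResidueField R) Y))
    (hZ : ∀ i < n, Subsingleton (ExtMod R i (ResidueField R) Z)) :
    ∃ rs : List R, rs.length = n ∧ (∀ r ∈ rs, r ∈ maximalIdeal R) ∧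
      IsWeaklyRegular X rs ∧ IsWeaklyRegular Y rs ∧ IsWeaklyRegular Z rs := by
  induction n generalizing X Y Z with
  | zero => exact ⟨[], rfl, by simp, .nil R X, .nil R Y, .nil R Z⟩
  | succ n ih =>
    have hom (V : Type u) [AddCommGroup V] [Module R V]
        (h : ∀ i < n + 1, Subsingleton (ExtMod R i (ResidueField R) V)) :
        Subsingleton (ResidueField R →ₗ[R] V) :=
      have := h 0 n.succ_pos
      (ExtMod.zeroEquiv (R := R)).symm.subsingleton
    have h1 := hom X hX
    have h2 := hom Y hY
    have h3 := hom Z hZ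
    -- An element of the maximal ideal regular on the product is regular on all three factors; it
    -- exists because k does not map nontrivially to the product.
    have : Subsingleton (ResidueField R →ₗ[R] X × Y × Z) := by
      refine ⟨fun f g ↦ ?_⟩
      have e1 := h1.elim (LinearMap.fst R X (Y × Z) ∘ₗ f) (LinearMap.fst R X (Y × Z) ∘ₗ g)
      have e2 := h2.elim (LinearMap.fst R Y Z ∘ₗ LinearMap.snd R X (Y × Z) ∘ₗ f)
        (LinearMap.fst R Y Z ∘ₗ LinearMap.snd R X (Y × Z) ∘ₗ g)
      have e3 := h3.elim (LinearMap.snd R Y Z ∘ₗ LinearMap.snd R X (Y × Z) ∘ₗ f)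
        (LinearMap.snd R Y Z ∘ₗ LinearMap.snd R X (Y × Z) ∘ₗ g)
      refine LinearMap.ext fun a ↦ Prod.ext ?_ (Prod.ext ?_ ?_)
      exacts [LinearMap.congr_fun e1 a, LinearMap.congr_fun e2 a, LinearMap.congr_fun e3 a]
    obtain ⟨x, hx, hreg⟩ := IsSMulRegular.subsingleton_linearMap_iff.mp this
    have hx : x ∈ maximalIdeal R := by
      rwa [show Module.annihilator R (ResidueField R) = _ from Ideal.annihilator_quotient] at hx
    have rX : IsSMulRegular X x := fun a b h ↦
      congr_arg Prod.fst (@hreg (a, 0, 0) (b, 0, 0) (by simpa using h))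
    have rY : IsSMulRegular Y x := fun a b h ↦
      congr_arg (fun p ↦ p.2.1) (@hreg (0, a, 0) (0, b, 0) (by simpa using h))
    have rZ : IsSMulRegular Z x := fun a b h ↦
      congr_arg (fun p ↦ p.2.2) (@hreg (0, 0, a) (0, 0, b) (by simpa using h))
    have quot (V : Type u) [AddCommGroup V] [Module R V] (hV : IsSMulRegular V x)
        (h : ∀ i < n + 1, Subsingleton (ExtMod R i (ResidueField R) V)) :
        ∀ i < n, Subsingleton (ExtMod R i (ResidueField R) (QuotSMulTop x V)) :=
      fun i hi ↦ ExtMod.subsingleton_right' (f := LinearMap.lsmul R V x) hV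
        (QuotSMulTop.mkQ_surjective x) (QuotSMulTop.exact_lsmul_mkQ x) (h i (by omega))
        (h (i + 1) (by omega))
    obtain ⟨rs, hl, hm, sX, sY, sZ⟩ := ih (quot X rX hX) (quot Y rY hY) (quot Z rZ hZ)
    exact ⟨x :: rs, by simp [hl], List.forall_mem_cons.mpr ⟨hx, hm⟩, .cons rX sX, .cons rY sY, .cons rZ sZ⟩

/-- Each regular element lowers the dimension by one, so R/(rs) has dimension zero. -/
theorem eq_maximalIdeal_of_ofList_le [IsNoetherianRing R] {rs : List R}
    (hm : ∀ r ∈ rs, r ∈ maximalIdeal R) (hr : IsWeaklyRegular R rs)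
    (hd : ringKrullDim R = rs.length) {p : Ideal R} [hp : p.IsPrime] (h : Ideal.ofList rs ≤ p) :
    p = maximalIdeal R := by
  have hreg := IsRegular.of_isWeaklyRegular_of_mem_maximalIdeal R hm hr
  have h1 := Module.supportDim_add_length_eq_supportDim_of_isRegular rs hreg
  rw [Module.supportDim_self_eq_ringKrullDim, hd] at h1
  have h2 : Module.supportDim R (R ⧸ Ideal.ofList rs • (⊤ : Submodule R R)) = 0 := by
    have : Nontrivial (R ⧸ Ideal.ofList rs • (⊤ : Submodule R R)) :=
      hreg.quot_ofList_smul_nontrivial _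
    have h0 := (Module.supportDim_ne_bot_iff_nontrivial R
      (R ⧸ Ideal.ofList rs • (⊤ : Submodule R R))).mpr this
    obtain ⟨a, ha⟩ := WithBot.ne_bot_iff_exists.mp h0
    rw [← ha] at h1 ⊢
    have h3 : a + (rs.length : ℕ∞) = 0 + (rs.length : ℕ∞) := by
      rw [zero_add]
      exact_mod_cast h1
    have : a = 0 := (ENat.add_left_injective_of_ne_top (ENat.natCast_ne_top rs.length)) h3
    rw [this]
    rfl
  have h3 := support_of_supportDim_eq_zero R _ h2
  rw [Module.support_eq_zeroLocus, Ideal.smul_eq_mul, Ideal.mul_top,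
    Ideal.annihilator_quotient] at h3
  have h4 : (⟨p, hp⟩ : PrimeSpectrum R) ∈ PrimeSpectrum.zeroLocus (Ideal.ofList rs : Set R) := h
  rw [h3] at h4
  exact ((maximalIdeal.isMaximal R).eq_of_le hp.ne_top h4).symm

end Depth

/-! ### Vanishing of Ext into a module of finite injective dimension -/

section ExtVanishing

open Pointwise RingTheory.Sequence

variable {R : Type u} [CommRing R] {X Y W : Type u}
  [AddCommGroup X] [Module R X] [AddCommGroup Y] [Module R Y] [AddCommGroup W] [Module R W]

/-- The module is X/(rs)X: dividing by one regular element raises the vanishing bound by one. -/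
theorem exists_quotient_ext_vanishing [IsLocalRing R] [Module.Finite R X] [Nontrivial X]
    {rs : List R} (hm : ∀ r ∈ rs, r ∈ maximalIdeal R) (hr : IsWeaklyRegular X rs) {c : ℕ}
    (h : ∀ i, c < i → Subsingleton (ExtMod R i X W)) :
    ∃ (Y : Type u) (_ : AddCommGroup Y) (_ : Module R Y), Module.Finite R Y ∧ Nontrivial Y ∧
      Module.annihilator R X ⊔ Ideal.ofList rs ≤ Module.annihilator R Y ∧
      ∀ i, c + rs.length < i → Subsingleton (ExtMod R i Y W) := by
  induction rs generalizing X c with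
  | nil => exact ⟨X, inferInstance, inferInstance, inferInstance, inferInstance, by simp, by simpa⟩
  | cons x rs ih =>
    obtain ⟨hx, hm⟩ := List.forall_mem_cons.mp hm
    obtain ⟨hreg, hr⟩ := (isWeaklyRegular_cons_iff X x rs).mp hr
    have := nontrivial_quotSMulTop_of_mem_maximalIdeal X hx
    obtain ⟨Y, _, _, hf, hn, ha, hY⟩ := ih (X := QuotSMulTop x X) (c := c + 1) hm hr fun i hi ↦ by
      obtain ⟨i, rfl⟩ := Nat.exists_eq_succ_of_ne_zero (Nat.ne_zero_of_lt hi)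
      exact ExtMod.subsingleton_right (f := LinearMap.lsmul R X x) hreg
        (QuotSMulTop.mkQ_surjective x) (QuotSMulTop.exact_lsmul_mkQ x) (h i (by omega))
        (h (i + 1) (by omega))
    refine ⟨Y, _, _, hf, hn, le_trans (sup_le (le_sup_of_le_left ?_) ?_) ha, fun i hi ↦ hY i ?_⟩
    · exact LinearMap.annihilator_le_of_surjective _ (QuotSMulTop.mkQ_surjective x)
    · rw [Ideal.ofList_cons]
      refine sup_le (le_sup_of_le_left ?_) le_sup_right
      rw [Ideal.span_singleton_le_iff_mem]
      exact QuotSMulTop.mem_annihilator X x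
    · simp only [List.length_cons] at hi
      omega

/-- An associated prime of `Y` contains `I`, hence is the maximal ideal. -/
theorem exists_injective_residueField [IsLocalRing R] [IsNoetherianRing R] [Nontrivial Y]
    {I : Ideal R} (hI : I ≤ Module.annihilator R Y)
    (hp : ∀ p : Ideal R, p.IsPrime → I ≤ p → p = maximalIdeal R) :
    ∃ f : ResidueField R →ₗ[R] Y, Function.Injective f := by
  obtain ⟨p, hass⟩ := associatedPrimes.nonempty R Y
  have : p = maximalIdeal R := hp p hass.isPrime (hI.trans (Submodule.annihilator_top.symm.le.trans hass.annihilator_le))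
  subst this
  exact (isAssociatedPrime_iff_exists_injective_linearMap _ _ |>.mp hass).2

/-- Dévissage to R/p. For p not maximal, some x in the maximal ideal is regular on R/p, and
vanishing in degree `i + 1` for the quotient by x gives vanishing in degree `i` by Nakayama. -/
theorem ext_vanishing_of_residueField [IsLocalRing R] [IsNoetherianRing R] [Module.Finite R W]
    {i : ℕ} (h : ∀ (Y : Type u) [AddCommGroup Y] [Module R Y] [Module.Finite R Y],
      Subsingleton (ExtMod R (i + 1) Y W))
    (hk : Subsingleton (ExtMod R i (ResidueField R) W)) [hY : Module.Finite R Y] :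
    Subsingleton (ExtMod R i Y W) := by
  induction hY using IsNoetherianRing.induction_on_isQuotientEquivQuotientPrime R with
  | subsingleton N => exact ExtMod.subsingleton_of_subsingleton i
  | quotient N p e =>
    rw [ExtMod.subsingleton_congr e]
    by_cases hp : p.1 = maximalIdeal R
    · rw [hp]
      exact hk
    · obtain ⟨x, hx, hxp⟩ : ∃ x ∈ maximalIdeal R, x ∉ p.1 := by
        by_contra! hle
        exact hp ((maximalIdeal.isMaximal R).eq_of_le p.2.ne_top hle).symm
      refine ExtMod.subsingleton_of_quotSMulTop (x := x) ?_ hx (h _)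
      refine IsSMulRegular.of_right_eq_zero_of_smul fun a ha ↦ ?_
      obtain ⟨a, rfl⟩ := Ideal.Quotient.mk_surjective a
      rw [Ideal.Quotient.eq_zero_iff_mem]
      have : x * a ∈ p.1 := Ideal.Quotient.eq_zero_iff_mem.mp ha
      exact (p.2.mem_or_mem this).resolve_left hxp
  | exact N₁ N₂ N₃ f g hf hg hfg h₁ h₃ => exact ExtMod.subsingleton_mid hf hg hfg h₁ h₃

/-- A finite module of finite injective dimension has injective dimension at most `d`, tested on
finite modules, if some regular sequence of length `d` generates an ideal primary to the maximal
ideal. -/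
theorem ext_vanishing_of_finite_injectiveDimension [IsLocalRing R] [IsNoetherianRing R]
    [Module.Finite R W] {m : ℕ} (hW : HasInjectiveDimensionLE (ModuleCat.of R W) m) {rs : List R}
    (hm : ∀ r ∈ rs, r ∈ maximalIdeal R) (hr : IsWeaklyRegular R rs)
    (hp : ∀ p : Ideal R, p.IsPrime → Ideal.ofList rs ≤ p → p = maximalIdeal R)
    {i : ℕ} (hi : rs.length < i) [Module.Finite R Y] : Subsingleton (ExtMod R i Y W) := by
  suffices H : ∀ (j i : ℕ), rs.length < i → m < i + j → ∀ (Y : Type u) [AddCommGroup Y]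
      [Module R Y] [Module.Finite R Y], Subsingleton (ExtMod R i Y W) from
    H (m + 1) i hi (by omega) Y
  -- Descending induction on `i`, starting above `m`; `j` bounds the distance.
  intro j
  induction j with
  | zero =>
    intro i _ hi Y _ _ _
    exact HasInjectiveDimensionLT.subsingleton (ModuleCat.of R W) (m + 1) i hi _
  | succ j ih =>
    intro i hi hij Y _ _ _
    have hsucc := ih (i + 1) (by omega) (by omega)
    refine ext_vanishing_of_residueField hsucc ?_
    obtain ⟨V, _, _, _, _, ha, hV⟩ := exists_quotient_ext_vanishing (X := R) (W := W) (c := 0) hm hr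
      fun i hi ↦ by
        obtain ⟨i, rfl⟩ := Nat.exists_eq_succ_of_ne_zero hi.ne'
        exact ExtMod.subsingleton_of_projective i
    -- Ext^i(k, W) lies between Ext^i(V, W), zero since `i` exceeds the length of `rs`, and
    -- Ext^{i+1}(V/k, W), zero by induction.
    obtain ⟨f, hf⟩ := exists_injective_residueField (le_sup_right.trans ha) hp
    exact ExtMod.subsingleton_left hf (Submodule.mkQ_surjective _) (f.exact_map_mkQ_range)
      (hV i (by omega)) (hsucc _)

theorem ext_vanishing_of_isWeaklyRegular [IsLocalRing R] [IsNoetherianRing R] [Module.Finite R W]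
    {d : ℕ} (hW : ∀ i, d < i → ∀ (Y : Type u) [AddCommGroup Y] [Module R Y] [Module.Finite R Y],
      Subsingleton (ExtMod R i Y W))
    [Module.Finite R X] {rs : List R} (hm : ∀ r ∈ rs, r ∈ maximalIdeal R)
    (hr : IsWeaklyRegular X rs) {i : ℕ} (hi : d < i + rs.length) :
    Subsingleton (ExtMod R i X W) := by
  induction rs generalizing X i with
  | nil => exact hW i hi X
  | cons x rs ih =>
    obtain ⟨hx, hm⟩ := List.forall_mem_cons.mp hm
    obtain ⟨hreg, hr⟩ := (isWeaklyRegular_cons_iff X x rs).mp hr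
    simp only [List.length_cons] at hi
    exact ExtMod.subsingleton_of_quotSMulTop hreg hx (ih hm hr (by omega))

theorem IsSMulRegular.exists_smul_eq_linearMap {x : R} (hx : IsSMulRegular W x) (f : X →ₗ[R] W)
    (h : ∀ a, (x • (⊤ : Submodule R W)).mkQ (f a) = 0) : ∃ g : X →ₗ[R] W, x • g = f := by
  choose g hg using fun a ↦ QuotSMulTop.exists_smul_of_mkQ_eq_zero (h a)
  exact ⟨⟨⟨g, fun a b ↦ hx (by simp [smul_add, hg])⟩, fun r a ↦ hx (by simp [smul_comm x r, hg])⟩,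
    LinearMap.ext hg⟩

/-- Vanishing of Ext^1 lifts maps from W/xW to W, and a map with values in xW is divisible by the
regular element `x`. -/
theorem exists_quotSMulTop_hom_equiv {x : R} (hx : IsSMulRegular W x)
    (h : Subsingleton (ExtMod R 1 X W)) :
    ∃ e : QuotSMulTop x (X →ₗ[R] W) ≃ₗ[R] (X →ₗ[R] QuotSMulTop x W),
      ∀ f, e ((x • (⊤ : Submodule R (X →ₗ[R] W))).mkQ f) =
        (x • (⊤ : Submodule R W)).mkQ ∘ₗ f := by
  let φ : (X →ₗ[R] W) →ₗ[R] (X →ₗ[R] QuotSMulTop x W) :=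
    LinearMap.llcomp R X W (QuotSMulTop x W) (x • (⊤ : Submodule R W)).mkQ
  have hφ : Function.Surjective φ := fun f ↦
    ExtMod.exists_lift (f := LinearMap.lsmul R W x) hx (QuotSMulTop.mkQ_surjective x)
      (QuotSMulTop.exact_lsmul_mkQ x) h f
  have hker : x • (⊤ : Submodule R (X →ₗ[R] W)) = LinearMap.ker φ := by
    ext f
    rw [LinearMap.mem_ker]
    constructor
    · intro hf
      obtain ⟨g, -, rfl⟩ := hf
      refine LinearMap.ext fun a ↦ ?_
      exact (Submodule.Quotient.mk_eq_zero _).mpr ⟨g a, trivial, rfl⟩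
    · intro hf
      obtain ⟨g, rfl⟩ := hx.exists_smul_eq_linearMap f (LinearMap.congr_fun hf)
      exact ⟨g, trivial, rfl⟩
  exact ⟨(Submodule.quotEquivOfEq _ _ hker).trans (φ.quotKerEquivOfSurjective hφ), fun f ↦ rfl⟩

theorem ExtMod.subsingleton_quotSMulTop_right {x : R} (hx : IsSMulRegular W x)
    (h : ∀ i, Subsingleton (ExtMod R (i + 1) X W)) (i : ℕ) :
    Subsingleton (ExtMod R (i + 1) X (QuotSMulTop x W)) :=
  ExtMod.subsingleton_right' (f := LinearMap.lsmul R W x) hx (QuotSMulTop.mkQ_surjective x)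
    (QuotSMulTop.exact_lsmul_mkQ x) (h i) (h (i + 1))

theorem IsSMulRegular.linearMap {x : R} (hx : IsSMulRegular W x) :
    IsSMulRegular (X →ₗ[R] W) x :=
  fun _ _ h ↦ LinearMap.ext fun a ↦ hx (LinearMap.congr_fun h a)

theorem RingTheory.Sequence.IsWeaklyRegular.linearMap {rs : List R} (hr : IsWeaklyRegular W rs)
    (h : ∀ i, Subsingleton (ExtMod R (i + 1) X W)) : IsWeaklyRegular (X →ₗ[R] W) rs := by
  induction rs generalizing W with
  | nil => exact .nil R _
  | cons x rs ih =>
    obtain ⟨hx, hr⟩ := (isWeaklyRegular_cons_iff W x rs).mp hr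
    obtain ⟨e, -⟩ := exists_quotSMulTop_hom_equiv hx (h 0)
    refine .cons hx.linearMap ((e.isWeaklyRegular_congr rs).mpr (ih hr ?_))
    exact ExtMod.subsingleton_quotSMulTop_right hx h

end ExtVanishing

/-! ### Duality for modules of finite length -/

section ArtinianDuality

open Abelian Pointwise RingTheory.Sequence

variable {R : Type u} [CommRing R] {L W : Type u}
  [AddCommGroup L] [Module R L] [AddCommGroup W] [Module R W]

/-- For the modules killed by `I`, the functor `Ext^s(-, W)` behaves as an exact duality: the
lower functors vanish, monomorphisms go to surjections, and the residue field is self-dual. -/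
structure IsExtDualizing [IsLocalRing R] (I : Ideal R) (W : Type u) [AddCommGroup W] [Module R W]
    (s : ℕ) : Prop where
  subsingleton : ∀ i < s, ∀ (L : Type u) [AddCommGroup L] [Module R L] [Module.Finite R L],
    I ≤ Module.annihilator R L → Subsingleton (ExtMod R i L W)
  surjective : ∀ (L' L : Type u) [AddCommGroup L'] [Module R L'] [AddCommGroup L] [Module R L]
    [Module.Finite R L'] [Module.Finite R L], I ≤ Module.annihilator R L →
    ∀ f : L' →ₗ[R] L, Function.Injective f → ∀ y : ExtMod R s L' W, ∃ z : ExtMod R s L W,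
      (Ext.mk₀ (ModuleCat.ofHom f)).comp z (zero_add s) = y
  residueField : Nonempty (ExtMod R s (ResidueField R) W ≃ₗ[R] ResidueField R)

/-- The short exact sequence given by multiplication with a regular element. -/
theorem IsSMulRegular.shortExact_lsmul_mkQ {x : R} (hx : IsSMulRegular W x) :
    (ModuleCat.shortComplexOfCompEqZero (LinearMap.lsmul R W x) (x • (⊤ : Submodule R W)).mkQ
      (QuotSMulTop.exact_lsmul_mkQ x).linearMap_comp_eq_zero).ShortExact :=
  LinearMap.shortExact_ofExact (f := LinearMap.lsmul R W x) hx (QuotSMulTop.mkQ_surjective x)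
    (QuotSMulTop.exact_lsmul_mkQ x)

/-- The connecting map is injective because Ext^s(L, W) = 0, and surjective because `x` kills `L`,
hence Ext^{s+1}(L, W). -/
theorem IsSMulRegular.comp_extClass_bijective {x : R} (hx : IsSMulRegular W x)
    (hL : x ∈ Module.annihilator R L) {s : ℕ} (h : Subsingleton (ExtMod R s L W)) :
    Function.Bijective (fun y : ExtMod R s L (QuotSMulTop x W) ↦
      (Ext.comp y hx.shortExact_lsmul_mkQ.extClass rfl : ExtMod R (s + 1) L W)) := by
  constructor
  · intro y y' hy
    rw [← sub_eq_zero]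
    obtain ⟨z, hz⟩ := Ext.covariant_sequence_exact₃ (ModuleCat.of R L) hx.shortExact_lsmul_mkQ
      (y - y') (n₁ := s + 1) rfl (by
        rw [sub_eq_add_neg, Ext.add_comp, Ext.neg_comp, ← sub_eq_add_neg]
        exact sub_eq_zero.mpr hy)
    rw [← hz, Subsingleton.elim (α := ExtMod R s L W) z 0, Ext.zero_comp]
  · intro z
    exact Ext.covariant_sequence_exact₁ (ModuleCat.of R L) hx.shortExact_lsmul_mkQ z
      (congr_arg (fun φ ↦ φ.hom z)
        (Ext.postcomp_smul_id_eq_zero_of_mem_annihilator (M := ModuleCat.of R W) hL (s + 1))) rfl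

theorem IsExtDualizing.quotSMulTop [IsLocalRing R] [IsNoetherianRing R] {I : Ideal R}
    (hI : I ≤ maximalIdeal R) {s : ℕ}
    (hW : IsExtDualizing I W (s + 1)) {x : R} (hx : IsSMulRegular W x) (hxI : x ∈ I) :
    IsExtDualizing I (QuotSMulTop x W) s where
  subsingleton i hi L _ _ _ hL :=
    ExtMod.subsingleton_right' (f := LinearMap.lsmul R W x) hx (QuotSMulTop.mkQ_surjective x)
      (QuotSMulTop.exact_lsmul_mkQ x) (hW.subsingleton i (by omega) L hL)
      (hW.subsingleton (i + 1) (by omega) L hL)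
  surjective L' L _ _ _ _ _ _ hL f hf y := by
    have hL' := hL.trans (LinearMap.annihilator_le_of_injective f hf)
    obtain ⟨z, hz⟩ := hW.surjective L' L hL f hf (y.comp hx.shortExact_lsmul_mkQ.extClass rfl)
    obtain ⟨y', rfl⟩ := (hx.comp_extClass_bijective (hL hxI)
      (hW.subsingleton s (by omega) L hL)).2 z
    refine ⟨y', (hx.comp_extClass_bijective (hL' hxI)
      (hW.subsingleton s (by omega) L' hL')).1 ?_⟩
    exact (Ext.comp_assoc _ _ _ _ _ (by omega)).trans hz
  residueField := by
    have hk : I ≤ Module.annihilator R (ResidueField R) :=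
      hI.trans (Ideal.annihilator_quotient (I := maximalIdeal R)).ge
    obtain ⟨e⟩ := hW.residueField
    refine ⟨(LinearEquiv.ofBijective (Ext.postcompOfLinear hx.shortExact_lsmul_mkQ.extClass R
      (ModuleCat.of R (ResidueField R)) (rfl : s + 1 = s + 1)) ?_).trans e⟩
    exact hx.comp_extClass_bijective (hk hxI) (hW.subsingleton s (by omega) _ hk)

theorem IsExtDualizing.hom_surjective [IsLocalRing R] {I : Ideal R} (hW : IsExtDualizing I W 0)
    {L' L : Type u} [AddCommGroup L'] [Module R L'] [AddCommGroup L] [Module R L]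
    [Module.Finite R L'] [Module.Finite R L] (hL : I ≤ Module.annihilator R L) {f : L' →ₗ[R] L}
    (hf : Function.Injective f) (φ : L' →ₗ[R] W) : ∃ ψ : L →ₗ[R] W, ψ ∘ₗ f = φ := by
  obtain ⟨y, hy⟩ := hW.surjective L' L hL f hf (Ext.mk₀ (ModuleCat.ofHom φ))
  obtain ⟨ψ, rfl⟩ := (Ext.mk₀_bijective _ _).2 y
  rw [Ext.mk₀_comp_mk₀] at hy
  exact ⟨ψ.hom, congr_arg ModuleCat.Hom.hom ((Ext.mk₀_bijective _ _).1 hy)⟩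

/-- The evaluation map `L → Hom(Hom(L, W), W)`. -/
def bidualEval (R : Type u) [CommRing R] (L W : Type u)
    [AddCommGroup L] [Module R L] [AddCommGroup W] [Module R W] :
    L →ₗ[R] (L →ₗ[R] W) →ₗ[R] W :=
  LinearMap.flip LinearMap.id

@[simp]
theorem bidualEval_apply (a : L) (f : L →ₗ[R] W) : bidualEval R L W a f = f a := rfl

theorem IsExtDualizing.bidualEval_bijective [IsLocalRing R] [IsNoetherianRing R] {I : Ideal R}
    (hp : ∀ p : Ideal R, p.IsPrime → I ≤ p → p = maximalIdeal R) (hW : IsExtDualizing I W 0)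
    [hf : Module.Finite R L] (hL : I ≤ Module.annihilator R L) :
    Function.Bijective (bidualEval R L W) := by
  revert hL
  induction hf using IsNoetherianRing.induction_on_isQuotientEquivQuotientPrime R with
  | subsingleton N =>
    intro _
    have : Subsingleton (N →ₗ[R] W) := ⟨fun f g ↦ LinearMap.ext fun a ↦ by
      rw [Subsingleton.elim a 0, map_zero, map_zero]⟩
    exact ⟨fun _ _ _ ↦ Subsingleton.elim _ _, fun f ↦ ⟨0, LinearMap.ext fun a ↦ by
      rw [Subsingleton.elim a 0, map_zero, map_zero]⟩⟩
  | quotient N p e =>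
    intro hN
    have hpm : p.1 = maximalIdeal R := by
      refine hp p.1 p.2 (hN.trans ?_)
      rw [e.annihilator_eq, Ideal.annihilator_quotient]
    rw [hpm] at e
    obtain ⟨σ⟩ := hW.residueField
    have e' : N ≃ₗ[R] ResidueField R := e
    have τ : (N →ₗ[R] W) ≃ₗ[R] ResidueField R :=
      (e'.arrowCongr (LinearEquiv.refl R W)).trans (ExtMod.zeroEquiv.symm.trans σ)
    have τ' : ((N →ₗ[R] W) →ₗ[R] W) ≃ₗ[R] ResidueField R :=
      (τ.arrowCongr (LinearEquiv.refl R W)).trans (ExtMod.zeroEquiv.symm.trans σ)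
    have hk : IsSimpleModule R (ResidueField R) :=
      isSimpleModule_iff_quot_maximal.mpr ⟨_, maximalIdeal.isMaximal R, ⟨LinearEquiv.refl R _⟩⟩
    have : IsSimpleModule R N := IsSimpleModule.congr e'
    have : IsSimpleModule R ((N →ₗ[R] W) →ₗ[R] W) := IsSimpleModule.congr τ'
    -- Both sides are isomorphic to k, hence simple, and a nonzero form on `N` shows that evaluation
    -- is not zero.
    refine (LinearMap.bijective_or_eq_zero (bidualEval R N W)).resolve_right fun h0 ↦ ?_
    have : Nontrivial (N →ₗ[R] W) := τ.toEquiv.nontrivial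
    obtain ⟨f, hf⟩ := exists_ne (0 : N →ₗ[R] W)
    exact hf (LinearMap.ext fun a ↦ LinearMap.congr_fun (LinearMap.congr_fun h0 a) f)
  | exact N₁ N₂ N₃ f g hf hg hfg h₁ h₃ =>
    intro hN
    obtain ⟨i₁, s₁⟩ := h₁ (hN.trans (LinearMap.annihilator_le_of_injective f hf))
    obtain ⟨i₃, s₃⟩ := h₃ (hN.trans (LinearMap.annihilator_le_of_surjective g hg))
    have hsurj := hW.hom_surjective hN hf
    constructor
    · refine (injective_iff_map_eq_zero _).mpr fun a ha ↦ ?_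
      have hga : g a = 0 := (injective_iff_map_eq_zero _).mp i₃ _
        (LinearMap.ext fun φ ↦ LinearMap.congr_fun ha (φ ∘ₗ g))
      obtain ⟨b, rfl⟩ := (hfg a).mp hga
      have : b = 0 := (injective_iff_map_eq_zero _).mp i₁ _ (LinearMap.ext fun φ ↦ by
        obtain ⟨ψ, rfl⟩ := hsurj φ
        exact LinearMap.congr_fun ha ψ)
      rw [this, map_zero]
    · intro Λ
      obtain ⟨c, hc⟩ := s₃ (Λ ∘ₗ LinearMap.lcomp R W g)
      obtain ⟨a, rfl⟩ := hg c
      have hzero (ψ : N₂ →ₗ[R] W) (hψ : ψ ∘ₗ f = 0) : Λ ψ = ψ a := by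
        obtain ⟨φ, rfl⟩ : ∃ φ : N₃ →ₗ[R] W, φ ∘ₗ g = ψ :=
          (LinearMap.exact_lcomp_of_exact_of_surjective W hfg hg ψ).mp hψ
        exact (LinearMap.congr_fun hc φ).symm
      choose ext hext using hsurj
      -- After subtracting evaluation at `a`, the functional depends only on the restriction to
      -- `N₁`, so it descends to the dual of `N₁`.
      have hdiff (ψ ψ' : N₂ →ₗ[R] W) (h : ψ ∘ₗ f = ψ' ∘ₗ f) : Λ ψ - ψ a = Λ ψ' - ψ' a := by
        have := hzero (ψ - ψ') (by rw [LinearMap.sub_comp, h, sub_self])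
        rw [map_sub, LinearMap.sub_apply] at this
        rw [sub_eq_sub_iff_sub_eq_sub, this]
      let Λ' : (N₁ →ₗ[R] W) →ₗ[R] W :=
        { toFun φ := Λ (ext φ) - ext φ a
          map_add' φ ψ := by
            rw [hdiff _ (ext φ + ext ψ) (by rw [LinearMap.add_comp, hext, hext, hext]), map_add,
              LinearMap.add_apply]
            abel
          map_smul' r φ := by
            rw [hdiff _ (r • ext φ) (by rw [LinearMap.smul_comp, hext, hext]), map_smul,
              LinearMap.smul_apply, RingHom.id_apply, smul_sub] }
      obtain ⟨b, hb⟩ := s₁ Λ'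
      refine ⟨a + f b, LinearMap.ext fun ψ ↦ ?_⟩
      have h1 : ψ (f b) = Λ (ext (ψ ∘ₗ f)) - ext (ψ ∘ₗ f) a := LinearMap.congr_fun hb (ψ ∘ₗ f)
      rw [bidualEval_apply, map_add, h1, hdiff _ ψ (hext _)]
      abel

end ArtinianDuality

/-! ### Biduality by reduction modulo a regular sequence -/

section Biduality

open Abelian Pointwise RingTheory.Sequence

variable {R : Type u} [CommRing R] {A B N W : Type u} [AddCommGroup A] [Module R A]
  [AddCommGroup B] [Module R B] [AddCommGroup N] [Module R N] [AddCommGroup W] [Module R W]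

/-- Nakayama, applied to the kernel, which is contained in x times itself, and to the range, which
is everything modulo x. -/
theorem LinearMap.bijective_of_quotSMulTop [IsLocalRing R] [IsNoetherianRing R]
    [Module.Finite R A] [Module.Finite R B] [Module.Finite R W] {x : R} (hx : x ∈ maximalIdeal R)
    (hxW : IsSMulRegular W x) (β : A →ₗ[R] B →ₗ[R] W)
    (β' : QuotSMulTop x A →ₗ[R] QuotSMulTop x B →ₗ[R] QuotSMulTop x W)
    (hβ : ∀ a b, β' ((x • (⊤ : Submodule R A)).mkQ a) ((x • (⊤ : Submodule R B)).mkQ b) =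
      (x • (⊤ : Submodule R W)).mkQ (β a b))
    (h : Function.Bijective β') : Function.Bijective β := by
  have hm := maximalIdeal_le_jacobson (⊥ : Ideal R)
  constructor
  · rw [← LinearMap.ker_eq_bot]
    refine Submodule.eq_bot_of_le_smul_of_le_jacobson_bot (maximalIdeal R) _
      (IsNoetherian.noetherian _) (fun a ha ↦ ?_) hm
    have h0 : (x • (⊤ : Submodule R A)).mkQ a = 0 := by
      refine (injective_iff_map_eq_zero _).mp h.1 _ (LinearMap.ext fun b ↦ ?_)
      obtain ⟨b, rfl⟩ := QuotSMulTop.mkQ_surjective x b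
      rw [hβ, LinearMap.mem_ker.mp ha, LinearMap.zero_apply, map_zero, LinearMap.zero_apply]
    obtain ⟨a', rfl⟩ := QuotSMulTop.exists_smul_of_mkQ_eq_zero h0
    refine Submodule.smul_mem_smul hx (hxW.linearMap ?_)
    simpa using ha
  · rw [← LinearMap.range_eq_top, ← top_le_iff]
    refine Submodule.le_of_le_smul_of_le_jacobson_bot (I := maximalIdeal R) Module.Finite.fg_top hm
      fun φ _ ↦ ?_
    obtain ⟨a, ha⟩ := h.2 (QuotSMulTop.map x φ)
    obtain ⟨a, rfl⟩ := QuotSMulTop.mkQ_surjective x a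
    obtain ⟨ψ, hψ⟩ := hxW.exists_smul_eq_linearMap (φ - β a) fun b ↦ by
      rw [LinearMap.sub_apply, map_sub, ← hβ, ha, sub_eq_zero]
      rfl
    rw [← add_sub_cancel (β a) φ, ← hψ]
    exact Submodule.add_mem_sup ⟨a, rfl⟩ (Submodule.smul_mem_smul hx trivial)

/-- A pairing `A × B → W` identifying `B` with `Hom(A, W)`, where `A` is a quotient of `N` with
`Hom(A, W) = Hom(N, W)`, also identifies `A` with `Hom(B, W)`. -/
theorem LinearMap.bijective_of_flip_bijective [IsLocalRing R] [IsNoetherianRing R] {I : Ideal R}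
    (hI : I ≤ maximalIdeal R) (hp : ∀ p : Ideal R, p.IsPrime → I ≤ p → p = maximalIdeal R)
    [Module.Finite R A] [Module.Finite R B] [Module.Finite R W] {rs : List R}
    (hrs : ∀ r ∈ rs, r ∈ I) (hW : IsExtDualizing I W rs.length)
    (hN : ∀ i, Subsingleton (ExtMod R (i + 1) N W)) (π : N →ₗ[R] A) (hπ : Function.Surjective π)
    (β : A →ₗ[R] B →ₗ[R] W) (hinj : Function.Injective β.flip)
    (hsurj : ∀ φ : N →ₗ[R] W, ∃ b, β.flip b ∘ₗ π = φ) (hr : IsWeaklyRegular W rs)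
    (hA : I ≤ Ideal.ofList rs ⊔ Module.annihilator R A) : Function.Bijective β := by
  induction rs generalizing A B W with
  -- All of `I` now kills `A`, so duality for such modules applies. `N` stays fixed along the
  -- induction, so that only Ext from `N` has to be followed, over the same ring.
  | nil =>
    rw [Ideal.ofList_nil, bot_sup_eq] at hA
    have hflip : Function.Bijective β.flip := by
      refine ⟨hinj, fun φ ↦ ?_⟩
      obtain ⟨b, hb⟩ := hsurj (φ ∘ₗ π)
      exact ⟨b, (LinearMap.cancel_right hπ).mp hb⟩
    let e := LinearEquiv.ofBijective β.flip hflip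
    have : β = (e.symm.arrowCongr (LinearEquiv.refl R W)).toLinearMap ∘ₗ bidualEval R A W := by
      refine LinearMap.ext fun a ↦ LinearMap.ext fun b ↦ ?_
      simp [LinearEquiv.arrowCongr_apply, e]
    rw [this]
    exact (e.symm.arrowCongr (LinearEquiv.refl R W)).bijective.comp (hW.bidualEval_bijective hp hA)
  | cons x rs ih =>
    obtain ⟨hx, hrs⟩ := List.forall_mem_cons.mp hrs
    obtain ⟨hreg, hr⟩ := (isWeaklyRegular_cons_iff W x rs).mp hr
    let β' : QuotSMulTop x A →ₗ[R] QuotSMulTop x B →ₗ[R] QuotSMulTop x W :=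
      (x • (⊤ : Submodule R A)).liftQ (QuotSMulTop.map x ∘ₗ β) (by
        rintro _ ⟨a, -, rfl⟩
        refine LinearMap.ext fun b ↦ ?_
        obtain ⟨b, rfl⟩ := QuotSMulTop.mkQ_surjective x b
        refine (Submodule.Quotient.mk_eq_zero _).mpr ⟨β a b, trivial, ?_⟩
        change _ = β (x • a) b
        rw [map_smul]
        rfl)
    have hβ (a b) : β' ((x • (⊤ : Submodule R A)).mkQ a) ((x • (⊤ : Submodule R B)).mkQ b) =
        (x • (⊤ : Submodule R W)).mkQ (β a b) := rfl
    refine LinearMap.bijective_of_quotSMulTop (hI hx) hreg β β' hβ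
      (ih hrs (hW.quotSMulTop hI hreg hx) (ExtMod.subsingleton_quotSMulTop_right hreg hN)
        ((x • (⊤ : Submodule R A)).mkQ ∘ₗ π) ((QuotSMulTop.mkQ_surjective x).comp hπ) β' ?_ ?_ hr ?_)
    · refine (injective_iff_map_eq_zero _).mpr fun b hb ↦ ?_
      obtain ⟨b, rfl⟩ := QuotSMulTop.mkQ_surjective x b
      obtain ⟨ψ, hψ⟩ := hreg.exists_smul_eq_linearMap (β.flip b ∘ₗ π) fun n ↦
        LinearMap.congr_fun hb ((x • (⊤ : Submodule R A)).mkQ (π n))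
      obtain ⟨b', rfl⟩ := hsurj ψ
      have : x • b' = b := by
        refine hinj ((LinearMap.cancel_right hπ).mp ?_)
        rw [map_smul, LinearMap.smul_comp, hψ]
      exact (Submodule.Quotient.mk_eq_zero _).mpr ⟨b', trivial, this⟩
    · intro φ
      obtain ⟨ψ, hψ⟩ := ExtMod.exists_lift (f := LinearMap.lsmul R W x) hreg
        (QuotSMulTop.mkQ_surjective x) (QuotSMulTop.exact_lsmul_mkQ x) (hN 0) φ
      obtain ⟨b, rfl⟩ := hsurj ψ
      exact ⟨(x • (⊤ : Submodule R B)).mkQ b, hψ⟩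
    · refine hA.trans ?_
      rw [Ideal.ofList_cons]
      refine sup_le (sup_le (le_sup_of_le_right ?_) le_sup_left) (le_sup_of_le_right ?_)
      · rw [Ideal.span_singleton_le_iff_mem]
        exact QuotSMulTop.mem_annihilator A x
      · exact LinearMap.annihilator_le_of_surjective _ (QuotSMulTop.mkQ_surjective x)

end Biduality

/-! ### Properties of the canonical module -/

section CanonicalModule

open Abelian Pointwise RingTheory.Sequence

variable {R : Type u} [CommRing R] [IsLocalRing R] {L W N ω : Type u} [AddCommGroup L] [Module R L]
  [AddCommGroup W] [Module R W] [AddCommGroup N] [Module R N] [AddCommGroup ω] [Module R ω]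

theorem ext_subsingleton_of_annihilator [IsNoetherianRing R] {I : Ideal R}
    (hp : ∀ p : Ideal R, p.IsPrime → I ≤ p → p = maximalIdeal R) {i : ℕ}
    (hk : Subsingleton (ExtMod R i (ResidueField R) W)) [hf : Module.Finite R L]
    (hL : I ≤ Module.annihilator R L) : Subsingleton (ExtMod R i L W) := by
  revert hL
  induction hf using IsNoetherianRing.induction_on_isQuotientEquivQuotientPrime R with
  | subsingleton N => exact fun _ ↦ ExtMod.subsingleton_of_subsingleton i
  | quotient N p e =>
    intro hN
    rw [ExtMod.subsingleton_congr e, hp p.1 p.2 (hN.trans ?_)]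
    · exact hk
    · rw [e.annihilator_eq, Ideal.annihilator_quotient]
  | exact N₁ N₂ N₃ f g hf hg hfg h₁ h₃ =>
    exact fun hN ↦ ExtMod.subsingleton_mid hf hg hfg
      (h₁ (hN.trans (LinearMap.annihilator_le_of_injective f hf)))
      (h₃ (hN.trans (LinearMap.annihilator_le_of_surjective g hg)))

theorem IsCanonicalModule.exists_isWeaklyRegular (hR : IsCMLocalRing R) (hω : IsCanonicalModule R ω)
    {d : ℕ} (hd : ringKrullDim R = d) [Module.Finite R N]
    (hN : ∀ i < d, Subsingleton (ExtMod R i (ResidueField R) N)) :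
    ∃ rs : List R, rs.length = d ∧ (∀ r ∈ rs, r ∈ maximalIdeal R) ∧
      (∀ p : Ideal R, p.IsPrime → Ideal.ofList rs ≤ p → p = maximalIdeal R) ∧
      IsWeaklyRegular R rs ∧ IsWeaklyRegular ω rs ∧ IsWeaklyRegular N rs := by
  have := hR.noetherian
  have := hω.isMCM.finite
  obtain ⟨rs, hl, hm, h1, h2, h3⟩ := exists_common_isWeaklyRegular
    ((isMCM_iff hd).mp ⟨inferInstance, hR.depth_eq⟩).2 ((isMCM_iff hd).mp hω.isMCM).2 hN
  exact ⟨rs, hl, hm, fun p _ ↦ eq_maximalIdeal_of_ofList_le hm h1 (by rw [hl, hd]), h1, h2, h3⟩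

theorem IsCanonicalModule.ext_vanishing (hR : IsCMLocalRing R) (hω : IsCanonicalModule R ω)
    {d : ℕ} (hd : ringKrullDim R = d) {i : ℕ} (hi : d < i) [Module.Finite R N] :
    Subsingleton (ExtMod R i N ω) := by
  have := hR.noetherian
  have := hω.isMCM.finite
  obtain ⟨m, hm⟩ := hω.finite_injectiveDimension
  obtain ⟨rs, rfl, hmem, hp, hrR, -, -⟩ :=
    hω.exists_isWeaklyRegular hR hd ((isMCM_iff hd).mp hω.isMCM).2
  exact ext_vanishing_of_finite_injectiveDimension hm hmem hrR hp hi

theorem IsCanonicalModule.ext_succ_subsingleton (hR : IsCMLocalRing R)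
    (hω : IsCanonicalModule R ω) {d : ℕ} (hd : ringKrullDim R = d) [Module.Finite R N]
    (hN : ∀ i < d, Subsingleton (ExtMod R i (ResidueField R) N)) (i : ℕ) :
    Subsingleton (ExtMod R (i + 1) N ω) := by
  have := hR.noetherian
  have := hω.isMCM.finite
  obtain ⟨rs, rfl, hmem, -, -, -, hrN⟩ := hω.exists_isWeaklyRegular hR hd hN
  exact ext_vanishing_of_isWeaklyRegular (fun i hi Y _ _ _ ↦ hω.ext_vanishing hR hd hi) hmem hrN
    (by omega)

theorem IsCanonicalModule.depth_dual (hR : IsCMLocalRing R)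
    (hω : IsCanonicalModule R ω) {d : ℕ} (hd : ringKrullDim R = d) [Module.Finite R N]
    (hN : ∀ i < d, Subsingleton (ExtMod R i (ResidueField R) N)) :
    ∀ i < d, Subsingleton (ExtMod R i (ResidueField R) (N →ₗ[R] ω)) := by
  have := hR.noetherian
  have := hω.isMCM.finite
  obtain ⟨rs, hl, hmem, -, -, hrω, -⟩ := hω.exists_isWeaklyRegular hR hd hN
  exact exists_isWeaklyRegular_iff_ext.mp
    ⟨rs, hl, hmem, hrω.linearMap (hω.ext_succ_subsingleton hR hd hN)⟩

/-- The three properties come from depth `d`, from the vanishing of Ext^{d+1}(-, ω) on finite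
modules, and from type one. -/
theorem IsCanonicalModule.isExtDualizing (hR : IsCMLocalRing R) (hω : IsCanonicalModule R ω)
    {d : ℕ} (hd : ringKrullDim R = d) {I : Ideal R}
    (hp : ∀ p : Ideal R, p.IsPrime → I ≤ p → p = maximalIdeal R) : IsExtDualizing I ω d := by
  have := hR.noetherian
  have := hω.isMCM.finite
  refine ⟨fun i hi L _ _ _ hL ↦ ?_, fun L' L _ _ _ _ _ _ hL f hf y ↦ ?_, ?_⟩
  · exact ext_subsingleton_of_annihilator hp (((isMCM_iff hd).mp hω.isMCM).2 i hi) hL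
  · exact Ext.contravariant_sequence_exact₁ (LinearMap.shortExact_ofExact hf
      (Submodule.mkQ_surjective _) f.exact_map_mkQ_range) (ModuleCat.of R ω) y (add_comm 1 d)
      ((hω.ext_vanishing hR hd d.lt_succ_self (N := L ⧸ LinearMap.range f)).elim _ _)
  · obtain ⟨d', hd', h⟩ := hω.type_eq_one
    obtain rfl : d = d' := by exact_mod_cast hd.symm.trans hd'
    exact h

theorem IsCanonicalModule.bidualEval_bijective (hR : IsCMLocalRing R)
    (hω : IsCanonicalModule R ω) {d : ℕ} (hd : ringKrullDim R = d) [Module.Finite R N]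
    (hN : ∀ i < d, Subsingleton (ExtMod R i (ResidueField R) N)) :
    Function.Bijective (bidualEval R N ω) := by
  have := hR.noetherian
  have := hω.isMCM.finite
  obtain ⟨rs, rfl, hmem, hp, -, hrω, -⟩ := hω.exists_isWeaklyRegular hR hd hN
  exact LinearMap.bijective_of_flip_bijective (Ideal.span_le.mpr hmem) hp
    (fun r hr ↦ Ideal.subset_span hr) (hω.isExtDualizing hR hd hp)
    (hω.ext_succ_subsingleton hR hd hN) LinearMap.id Function.surjective_id (bidualEval R N ω)
    (fun f g h ↦ h) (fun φ ↦ ⟨φ, rfl⟩) hrω le_sup_left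

end CanonicalModule

/-! ### Acyclic modules -/

section ExtAcyclic

open Abelian

/-- The modules `X` with `Ext^i(X, W) = 0` for all `i > 0`. -/
def IsExtAcyclic (R : Type u) [CommRing R] (X W : Type u) [AddCommGroup X] [Module R X]
    [AddCommGroup W] [Module R W] : Prop :=
  ∀ i, Subsingleton (ExtMod R (i + 1) X W)

variable {R : Type u} [CommRing R] {A B C P X W : Type u} [AddCommGroup A] [Module R A]
  [AddCommGroup B] [Module R B] [AddCommGroup C] [Module R C] [AddCommGroup P] [Module R P]
  [AddCommGroup X] [Module R X] [AddCommGroup W] [Module R W]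

theorem IsExtAcyclic.congr (e : A ≃ₗ[R] B) (h : IsExtAcyclic R A W) : IsExtAcyclic R B W :=
  fun i ↦ (ExtMod.subsingleton_congr e _).mp (h i)

theorem IsExtAcyclic.of_subsingleton [Subsingleton A] : IsExtAcyclic R A W :=
  fun i ↦ ExtMod.subsingleton_of_subsingleton (i + 1)

theorem IsExtAcyclic.mid {f : A →ₗ[R] B} {g : B →ₗ[R] C} (hf : Function.Injective f)
    (hg : Function.Surjective g) (h : Function.Exact f g) (hA : IsExtAcyclic R A W)
    (hC : IsExtAcyclic R C W) : IsExtAcyclic R B W :=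
  fun i ↦ ExtMod.subsingleton_mid hf hg h (hA i) (hC i)

theorem IsExtAcyclic.left {f : A →ₗ[R] B} {g : B →ₗ[R] C} (hf : Function.Injective f)
    (hg : Function.Surjective g) (h : Function.Exact f g) (hB : IsExtAcyclic R B W)
    (hC : IsExtAcyclic R C W) : IsExtAcyclic R A W :=
  fun i ↦ ExtMod.subsingleton_left hf hg h (hB i) (hC (i + 1))

theorem ExtMod.subsingleton_one_of_exists_lift {f : A →ₗ[R] B} {g : B →ₗ[R] C}
    (hf : Function.Injective f) (hg : Function.Surjective g) (h : Function.Exact f g)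
    (hB : Subsingleton (ExtMod R 1 X B)) (hlift : ∀ φ : X →ₗ[R] C, ∃ ψ : X →ₗ[R] B, g ∘ₗ ψ = φ) :
    Subsingleton (ExtMod R 1 X A) := by
  refine subsingleton_of_forall_eq 0 fun x ↦ ?_
  obtain ⟨y, rfl⟩ := Ext.covariant_sequence_exact₁ _ (LinearMap.shortExact_ofExact hf hg h) x
    (Subsingleton.elim (α := ExtMod R 1 X B) _ _) (zero_add 1)
  obtain ⟨φ, rfl⟩ := (Ext.mk₀_bijective _ _).2 y
  obtain ⟨ψ, hψ⟩ := hlift φ.hom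
  have : φ = ModuleCat.ofHom ψ ≫
      (ModuleCat.shortComplexOfCompEqZero f g h.linearMap_comp_eq_zero).g := by
    ext a
    exact LinearMap.congr_fun hψ.symm a
  rw [this, ← Ext.mk₀_comp_mk₀, Ext.comp_assoc_of_second_deg_zero]
  rw [ShortComplex.ShortExact.comp_extClass, Ext.comp_zero]

theorem exists_injective_embedding (R : Type u) [CommRing R] (W : Type u) [AddCommGroup W]
    [Module R W] : ∃ (J : Type u) (_ : AddCommGroup J) (_ : Module R J) (f : W →ₗ[R] J),
      Function.Injective f ∧ ∀ (L : Type u) [AddCommGroup L] [Module R L] (i : ℕ),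
        Subsingleton (ExtMod R (i + 1) L J) :=
  ⟨(Injective.under (ModuleCat.of R W) : ModuleCat.{u} R), inferInstance, inferInstance,
    (Injective.ι (ModuleCat.of R W)).hom, (ModuleCat.mono_iff_injective _).mp inferInstance,
    fun L _ _ i ↦ Ext.subsingleton_of_injective (ModuleCat.of R L)
      (Injective.under (ModuleCat.of R W)) i⟩

/-- Degree one is the tensor-hom adjunction with projectivity of `P`; higher degrees follow by
dimension shifting in `W`. No finiteness of `P` is needed, so any projective resolution can be used.
-/
theorem IsExtAcyclic.tensor [Module.Projective R P] (h : IsExtAcyclic R X W) :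
    IsExtAcyclic R (P ⊗[R] X) W := by
  intro i
  induction i generalizing W with
  | zero =>
    obtain ⟨J, _, _, f, hf, hJ⟩ := exists_injective_embedding R W
    refine ExtMod.subsingleton_one_of_exists_lift hf (Submodule.mkQ_surjective _)
      f.exact_map_mkQ_range (hJ _ 0) fun φ ↦ ?_
    have hs : Function.Surjective (LinearMap.llcomp R X J _ (LinearMap.range f).mkQ) := fun φ ↦
      ExtMod.exists_lift hf (Submodule.mkQ_surjective _) f.exact_map_mkQ_range (h 0) φ
    obtain ⟨ψ, hψ⟩ := Module.projective_lifting_property _ (TensorProduct.curry φ) hs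
    refine ⟨TensorProduct.lift ψ, TensorProduct.ext' fun p x ↦ ?_⟩
    exact LinearMap.congr_fun (LinearMap.congr_fun hψ p) x
  | succ i ih =>
    obtain ⟨J, _, _, f, hf, hJ⟩ := exists_injective_embedding R W
    refine ExtMod.subsingleton_left' hf (Submodule.mkQ_surjective _) f.exact_map_mkQ_range
      (ih fun j ↦ ?_) (hJ _ _)
    exact ExtMod.subsingleton_right' hf (Submodule.mkQ_surjective _) f.exact_map_mkQ_range
      (hJ X j) (h (j + 1))

end ExtAcyclic

/-! ### Dualizing a complex with acyclic homology -/

section Opcycles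

variable {R : Type u} [CommRing R] {A B C ω : Type u} [AddCommGroup A] [Module R A]
  [AddCommGroup B] [Module R B] [AddCommGroup C] [Module R C] [AddCommGroup ω] [Module R ω]

/-- The map `B / im f → C` induced by `g` in a complex `A → B → C`. Its kernel is the homology. -/
def quotientRangeMap {f : A →ₗ[R] B} {g : B →ₗ[R] C} (h : g ∘ₗ f = 0) :
    (B ⧸ LinearMap.range f) →ₗ[R] C :=
  (LinearMap.range f).liftQ g (LinearMap.range_le_ker_iff.mpr h)

variable {f : A →ₗ[R] B} {g : B →ₗ[R] C} (h : g ∘ₗ f = 0)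

include h in
theorem quotientRangeMap_range : LinearMap.range (quotientRangeMap h) = LinearMap.range g :=
  Submodule.range_liftQ _ _ _

theorem exact_ker_quotientRangeMap : Function.Exact (LinearMap.ker (quotientRangeMap h)).subtype
    (quotientRangeMap h).rangeRestrict := by
  rw [LinearMap.exact_iff, LinearMap.ker_rangeRestrict, Submodule.range_subtype]

/-- If `Ext^1` of the boundaries of `C` and of the cokernel of `g` vanish, then the homology of
the dual of `A → B → C` is the dual of its homology. -/
theorem exists_restrict_ker_quotientRangeMap (h₁ : IsExtAcyclic R (LinearMap.range g) ω)
    (h₂ : IsExtAcyclic R (C ⧸ LinearMap.range g) ω) :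
    ∃ ρ : LinearMap.ker (LinearMap.lcomp R ω f) →ₗ[R] (LinearMap.ker (quotientRangeMap h) →ₗ[R] ω),
      Function.Surjective ρ ∧ ∀ φ, ρ φ = 0 ↔ ∃ θ : C →ₗ[R] ω, θ ∘ₗ g = φ.1 := by
  let ρ : LinearMap.ker (LinearMap.lcomp R ω f) →ₗ[R] (LinearMap.ker (quotientRangeMap h) →ₗ[R] ω) :=
    { toFun φ := (LinearMap.range f).liftQ φ.1
        (LinearMap.range_le_ker_iff.mpr (LinearMap.mem_ker.mp φ.2)) ∘ₗ Submodule.subtype _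
      map_add' φ ψ := by
        refine LinearMap.ext fun ⟨a, _⟩ ↦ ?_
        obtain ⟨a, rfl⟩ := Submodule.mkQ_surjective _ a
        rfl
      map_smul' r φ := by
        refine LinearMap.ext fun ⟨a, _⟩ ↦ ?_
        obtain ⟨a, rfl⟩ := Submodule.mkQ_surjective _ a
        rfl }
  have hρ (φ) (b : B) (hb : g b = 0) :
      ρ φ ⟨(LinearMap.range f).mkQ b, LinearMap.mem_ker.mpr hb⟩ = φ.1 b := rfl
  have hrange : IsExtAcyclic R (LinearMap.range (quotientRangeMap h)) ω := by
    rwa [quotientRangeMap_range]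
  refine ⟨ρ, fun χ ↦ ?_, fun φ ↦ ⟨fun hφ ↦ ?_, ?_⟩⟩
  -- A form on the homology extends to `B / im f`, the obstruction lying in Ext^1(im g, ω) = 0.
  · obtain ⟨ψ, hψ⟩ := ExtMod.exists_extension (Submodule.subtype_injective _)
      (quotientRangeMap h).surjective_rangeRestrict (exact_ker_quotientRangeMap h) (hrange 0) χ
    refine ⟨⟨ψ ∘ₗ (LinearMap.range f).mkQ, ?_⟩, LinearMap.ext fun ⟨a, ha⟩ ↦ ?_⟩
    · refine LinearMap.ext fun a ↦ ?_
      have : (LinearMap.range f).mkQ (f a) = 0 := (Submodule.Quotient.mk_eq_zero _).mpr ⟨a, rfl⟩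
      change ψ ((LinearMap.range f).mkQ (f a)) = 0
      rw [this, map_zero]
    · obtain ⟨a, rfl⟩ := Submodule.mkQ_surjective _ a
      exact LinearMap.congr_fun hψ ⟨_, ha⟩
  -- A form vanishing on `ker g` lives on `im g`, and extends to `C` because Ext^1(C / im g, ω) = 0.
  · have hle : LinearMap.ker g ≤ LinearMap.ker φ.1 := fun b hb ↦
      (hρ φ b hb).symm.trans (LinearMap.congr_fun hφ _)
    let θ : LinearMap.range g →ₗ[R] ω :=
      (LinearMap.ker g).liftQ φ.1 hle ∘ₗ g.quotKerEquivRange.symm.toLinearMap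
    obtain ⟨θ', hθ'⟩ := ExtMod.exists_extension (Submodule.subtype_injective _)
      (Submodule.mkQ_surjective _) (LinearMap.exact_subtype_mkQ _) (h₂ 0) θ
    refine ⟨θ', LinearMap.ext fun b ↦ ?_⟩
    have h1 : θ' (g b) = θ ⟨g b, b, rfl⟩ := LinearMap.congr_fun hθ' ⟨g b, b, rfl⟩
    have h2 : g.quotKerEquivRange.symm ⟨g b, b, rfl⟩ = (LinearMap.ker g).mkQ b :=
      g.quotKerEquivRange_symm_apply_image b ⟨b, rfl⟩
    change θ' (g b) = φ.1 b
    rw [h1]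
    change (LinearMap.ker g).liftQ φ.1 hle (g.quotKerEquivRange.symm ⟨g b, b, rfl⟩) = φ.1 b
    rw [h2]
    rfl
  · rintro ⟨θ, hθ⟩
    refine LinearMap.ext fun ⟨a, ha⟩ ↦ ?_
    obtain ⟨a, rfl⟩ := Submodule.mkQ_surjective _ a
    have ha' : g a = 0 := ha
    rw [hρ φ a ha', ← hθ, LinearMap.comp_apply, ha', map_zero, LinearMap.zero_apply]

/-- In a complex of acyclic modules whose first homology modules are acyclic, the boundaries and
the cokernels of the differentials are acyclic too. -/
theorem isExtAcyclic_range_and_quotient {X : ℕ → Type u} [∀ j, AddCommGroup (X j)]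
    [∀ j, Module R (X j)] (d : ∀ j, X (j + 1) →ₗ[R] X j) (hd : ∀ j, d j ∘ₗ d (j + 1) = 0)
    (hX : ∀ j, IsExtAcyclic R (X j) ω) (h₀ : IsExtAcyclic R (X 0 ⧸ LinearMap.range (d 0)) ω)
    {n : ℕ} (hH : ∀ j < n, IsExtAcyclic R (LinearMap.ker (quotientRangeMap (hd j))) ω) :
    IsExtAcyclic R (LinearMap.range (d n)) ω ∧ IsExtAcyclic R (X n ⧸ LinearMap.range (d n)) ω := by
  have key (j : ℕ) (hj : IsExtAcyclic R (X j ⧸ LinearMap.range (d j)) ω) :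
      IsExtAcyclic R (LinearMap.range (d j)) ω :=
    .left (Submodule.subtype_injective _) (Submodule.mkQ_surjective _)
      (LinearMap.exact_subtype_mkQ _) (hX j) hj
  induction n with
  | zero => exact ⟨key 0 h₀, h₀⟩
  | succ n ih =>
    have hn := (ih fun j hj ↦ hH j (by omega)).1
    rw [← quotientRangeMap_range (hd n)] at hn
    -- The next cokernel is an extension of the boundaries in degree `n` by the homology in degree
    -- `n + 1`.
    have := IsExtAcyclic.mid (Submodule.subtype_injective _)
      (quotientRangeMap (hd n)).surjective_rangeRestrict (exact_ker_quotientRangeMap (hd n))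
      (hH n n.lt_succ_self) hn
    exact ⟨key _ this, this⟩

end Opcycles

/-! ### Ext and Tor from a projective resolution -/

section Resolutions

open Abelian

variable {R : Type u} [CommRing R]

/-- This presents Ext as cocycles modulo coboundaries, ready for comparison with another quotient of
the cocycles. -/
theorem exists_cocycle_to_ext {X : ModuleCat.{u} R} (F : ProjectiveResolution X)
    (Y : Type u) [AddCommGroup Y] [Module R Y] (p : ℕ) :
    ∃ σ : LinearMap.ker (LinearMap.lcomp R Y (F.complex.d (p + 2) (p + 1)).hom) →ₗ[R]
        ExtMod R (p + 1) X Y, Function.Surjective σ ∧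
      ∀ φ, σ φ = 0 ↔ ∃ θ : F.complex.X p →ₗ[R] Y, θ ∘ₗ (F.complex.d (p + 1) p).hom = φ.1 := by
  have hz (φ : LinearMap.ker (LinearMap.lcomp R Y (F.complex.d (p + 2) (p + 1)).hom)) :
      F.complex.d (p + 2) (p + 1) ≫ ModuleCat.ofHom φ.1 = 0 :=
    ModuleCat.hom_ext (LinearMap.mem_ker.mp φ.2)
  let σ : LinearMap.ker (LinearMap.lcomp R Y (F.complex.d (p + 2) (p + 1)).hom) →ₗ[R]
      ExtMod R (p + 1) X Y :=
    { toFun φ := F.extMk (ModuleCat.ofHom φ.1) (p + 2) rfl (hz φ)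
      map_add' φ ψ := (F.add_extMk _ _ _ _ (hz φ) (hz ψ)).symm
      map_smul' r φ := by
        rw [RingHom.id_apply, Ext.smul_eq_comp_mk₀, F.extMk_comp_mk₀]
        congr 1 }
  refine ⟨σ, fun y ↦ ?_, fun φ ↦ ?_⟩
  · obtain ⟨f, hf, rfl⟩ := F.extMk_surjective y (p + 2) rfl
    exact ⟨⟨f.hom, LinearMap.mem_ker.mpr (congr_arg ModuleCat.Hom.hom hf)⟩, rfl⟩
  · refine (F.extMk_eq_zero_iff _ _ rfl (hz φ) p rfl).trans ⟨?_, ?_⟩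
    · rintro ⟨g, hg⟩
      exact ⟨g.hom, congr_arg ModuleCat.Hom.hom hg⟩
    · rintro ⟨θ, hθ⟩
      exact ⟨ModuleCat.ofHom θ, ModuleCat.hom_ext hθ⟩

theorem CategoryTheory.ShortComplex.nonempty_homology_equiv (S : ShortComplex (ModuleCat.{u} R)) :
    Nonempty (S.homology ≃ₗ[R]
      LinearMap.ker (quotientRangeMap (congr_arg ModuleCat.Hom.hom S.zero :
        S.g.hom ∘ₗ S.f.hom = 0))) := by
  let h : S.g.hom ∘ₗ S.f.hom = 0 := congr_arg ModuleCat.Hom.hom S.zero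
  let ψ : LinearMap.ker S.g.hom →ₗ[R] LinearMap.ker (quotientRangeMap h) :=
    ((LinearMap.range S.f.hom).mkQ ∘ₗ Submodule.subtype _).codRestrict _ fun a ↦
      LinearMap.mem_ker.mpr a.2
  have hψ : Function.Surjective ψ := by
    rintro ⟨a, ha⟩
    obtain ⟨a, rfl⟩ := Submodule.mkQ_surjective _ a
    exact ⟨⟨a, ha⟩, rfl⟩
  have hker : LinearMap.range S.moduleCatToCycles = LinearMap.ker ψ := by
    ext ⟨a, ha⟩
    rw [LinearMap.mem_ker, Subtype.ext_iff]
    refine Iff.trans ?_ (Submodule.Quotient.mk_eq_zero (LinearMap.range S.f.hom)).symm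
    constructor
    · rintro ⟨b, hb⟩
      exact ⟨b, congr_arg Subtype.val hb⟩
    · rintro ⟨b, hb⟩
      exact ⟨b, Subtype.ext hb⟩
  exact ⟨S.moduleCatHomologyIso.toLinearEquiv.trans
    ((Submodule.quotEquivOfEq _ _ hker).trans (ψ.quotKerEquivOfSurjective hψ))⟩

theorem TorMod.nonempty_equiv_homology {M : Type u} [AddCommGroup M] [Module R M]
    (F : ProjectiveResolution (ModuleCat.of R M)) (B : Type u) [AddCommGroup B] [Module R B]
    {i j k : ℕ} (hi : (ComplexShape.down ℕ).prev j = i) (hk : (ComplexShape.down ℕ).next j = k)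
    (h : (F.complex.d j k).hom.rTensor B ∘ₗ (F.complex.d i j).hom.rTensor B = 0) :
    Nonempty (TorMod R j M B ≃ₗ[R] LinearMap.ker (quotientRangeMap h)) := by
  let T := (MonoidalCategory.tensoringRight (ModuleCat.{u} R)).obj (ModuleCat.of R B)
  let K := (T.mapHomologicalComplex _).obj F.complex
  obtain ⟨e⟩ := ShortComplex.nonempty_homology_equiv (K.sc' i j k)
  exact ⟨((F.isoLeftDerivedObj T j).toLinearEquiv.trans
    (K.homologyIsoSc' i j k hi hk).toLinearEquiv).trans e⟩

end Resolutions

/-! ### Comparison of Ext with the dual of Tor -/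

section Comparison

open Abelian

variable {R : Type u} [CommRing R] {M N ω : Type u} [AddCommGroup M] [Module R M]
  [AddCommGroup N] [Module R N] [AddCommGroup ω] [Module R ω]

/-- For a reflexive module `N`, homomorphisms `P → N` are the same as forms on `P ⊗ N^∨`. -/
noncomputable def homEquivTensorDual (P : Type u) [AddCommGroup P] [Module R P]
    (hN : Function.Bijective (bidualEval R N ω)) :
    (P →ₗ[R] N) ≃ₗ[R] (P ⊗[R] (N →ₗ[R] ω) →ₗ[R] ω) :=
  ((LinearEquiv.refl R P).arrowCongr (LinearEquiv.ofBijective _ hN)).trans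
    (TensorProduct.lift.equiv (RingHom.id R) P (N →ₗ[R] ω) ω)

theorem homEquivTensorDual_tmul {P : Type u} [AddCommGroup P] [Module R P]
    (hN : Function.Bijective (bidualEval R N ω)) (φ : P →ₗ[R] N) (p : P) (b : N →ₗ[R] ω) :
    homEquivTensorDual P hN φ (p ⊗ₜ b) = b (φ p) := rfl

theorem homEquivTensorDual_comp {P Q : Type u} [AddCommGroup P] [Module R P] [AddCommGroup Q]
    [Module R Q] (hN : Function.Bijective (bidualEval R N ω)) (φ : P →ₗ[R] N) (f : Q →ₗ[R] P) :
    homEquivTensorDual Q hN (φ ∘ₗ f) =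
      homEquivTensorDual P hN φ ∘ₗ f.rTensor (N →ₗ[R] ω) := by
  refine TensorProduct.ext' fun q b ↦ ?_
  rw [LinearMap.comp_apply, LinearMap.rTensor_tmul, homEquivTensorDual_tmul,
    homEquivTensorDual_tmul, LinearMap.comp_apply]

theorem CategoryTheory.ProjectiveResolution.rTensor_comp_eq_zero (F : ProjectiveResolution (ModuleCat.of R M))
    (B : Type u) [AddCommGroup B] [Module R B] (i j k : ℕ) :
    (F.complex.d j k).hom.rTensor B ∘ₗ (F.complex.d i j).hom.rTensor B = 0 := by
  rw [← LinearMap.rTensor_comp, ← ModuleCat.hom_comp, F.complex.d_comp_d, ModuleCat.hom_zero,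
    LinearMap.rTensor_zero]

theorem CategoryTheory.ProjectiveResolution.nonempty_quotient_equiv (F : ProjectiveResolution (ModuleCat.of R M))
    (B : Type u) [AddCommGroup B] [Module R B] (j : ℕ) :
    Nonempty (((F.complex.X j : ModuleCat.{u} R) ⊗[R] B ⧸
      LinearMap.range ((F.complex.d (j + 1) j).hom.rTensor B)) ≃ₗ[R] syzygy F j ⊗[R] B) := by
  cases j with
  | zero =>
    have hex := (ShortComplex.ShortExact.moduleCat_exact_iff_function_exact _).mp F.exact₀
    exact ⟨rTensor.equiv B hex ((ModuleCat.epi_iff_surjective (F.π.f 0)).mp inferInstance)⟩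
  | succ j =>
    have hex := (ShortComplex.ShortExact.moduleCat_exact_iff_function_exact _).mp (F.exact_succ j)
    have : Function.Exact (F.complex.d (j + 2) (j + 1)).hom
        (F.complex.d (j + 1) j).hom.rangeRestrict := by
      rw [LinearMap.exact_iff, LinearMap.ker_rangeRestrict]
      exact LinearMap.exact_iff.mp hex
    exact ⟨rTensor.equiv B this (LinearMap.surjective_rangeRestrict _)⟩

theorem TorMod.nonempty_zero_equiv (F : ProjectiveResolution (ModuleCat.of R M))
    (B : Type u) [AddCommGroup B] [Module R B] :
    Nonempty (TorMod R 0 M B ≃ₗ[R] ((F.complex.X 0 : ModuleCat.{u} R) ⊗[R] B ⧸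
      LinearMap.range ((F.complex.d 1 0).hom.rTensor B))) := by
  -- Degree 0 has no successor, so `next` takes the default value 0; the differential from 0 to 0 is
  -- zero and the kernel is everything.
  obtain ⟨e⟩ := TorMod.nonempty_equiv_homology F B (i := 1) (j := 0) (k := 0) (by simp) (by simp)
    (ProjectiveResolution.rTensor_comp_eq_zero F B 1 0 0)
  have : LinearMap.ker (quotientRangeMap (ProjectiveResolution.rTensor_comp_eq_zero F B 1 0 0)) = ⊤ := by
    rw [LinearMap.ker_eq_top, ← LinearMap.range_eq_bot, quotientRangeMap_range, LinearMap.range_eq_bot,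
      F.complex.shape 0 0 (by simp), ModuleCat.hom_zero, LinearMap.rTensor_zero]
  exact ⟨e.trans (LinearEquiv.ofTop _ this)⟩

theorem TorMod.nonempty_succ_equiv (F : ProjectiveResolution (ModuleCat.of R M))
    (B : Type u) [AddCommGroup B] [Module R B] (j : ℕ) :
    Nonempty (TorMod R (j + 1) M B ≃ₗ[R] LinearMap.ker (quotientRangeMap
      (ProjectiveResolution.rTensor_comp_eq_zero F B (j + 2) (j + 1) j))) :=
  TorMod.nonempty_equiv_homology F B (by simp) (by simp) _

theorem nonempty_ext_zero_equiv (hN : Function.Bijective (bidualEval R N ω)) :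
    Nonempty (ExtMod R 0 M N ≃ₗ[R] (TorMod R 0 M (N →ₗ[R] ω) →ₗ[R] ω)) := by
  let F := projectiveResolution (ModuleCat.of R M)
  obtain ⟨e⟩ := TorMod.nonempty_zero_equiv F (N →ₗ[R] ω)
  obtain ⟨e'⟩ := ProjectiveResolution.nonempty_quotient_equiv F (N →ₗ[R] ω) 0
  exact ⟨(ExtMod.zeroEquiv.trans (homEquivTensorDual M hN)).trans
    ((e.trans e').symm.arrowCongr (LinearEquiv.refl R ω))⟩

theorem nonempty_ext_succ_equiv (hN : Function.Bijective (bidualEval R N ω))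
    (hB : IsExtAcyclic R (N →ₗ[R] ω) ω) {p : ℕ}
    (hTor : ∀ j ≤ p, IsExtAcyclic R (TorMod R j M (N →ₗ[R] ω)) ω) :
    Nonempty (ExtMod R (p + 1) M N ≃ₗ[R] (TorMod R (p + 1) M (N →ₗ[R] ω) →ₗ[R] ω)) := by
  let F := projectiveResolution (ModuleCat.of R M)
  have hproj (j : ℕ) : Module.Projective R (F.complex.X j) :=
    (IsProjective.iff_projective _).mpr (F.projective j)
  obtain ⟨h₁, h₂⟩ := isExtAcyclic_range_and_quotient (n := p)
    (X := fun j ↦ (F.complex.X j : ModuleCat.{u} R) ⊗[R] (N →ₗ[R] ω))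
    (fun j ↦ (F.complex.d (j + 1) j).hom.rTensor (N →ₗ[R] ω))
    (fun j ↦ ProjectiveResolution.rTensor_comp_eq_zero F _ (j + 2) (j + 1) j) (fun j ↦ hB.tensor)
    ((hTor 0 p.zero_le).congr (TorMod.nonempty_zero_equiv F _).some)
    (fun j hj ↦ (hTor (j + 1) hj).congr (TorMod.nonempty_succ_equiv F _ j).some)
  obtain ⟨ρ, hρ, hρ0⟩ := exists_restrict_ker_quotientRangeMap
    (ProjectiveResolution.rTensor_comp_eq_zero F _ (p + 2) (p + 1) p) h₁ h₂
  obtain ⟨σ, hσ, hσ0⟩ := exists_cocycle_to_ext F N p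
  obtain ⟨e⟩ := TorMod.nonempty_succ_equiv F (N →ₗ[R] ω) p
  let T (j : ℕ) := homEquivTensorDual (F.complex.X j) hN
  have hT (φ : F.complex.X (p + 1) →ₗ[R] N) :
      φ ∈ LinearMap.ker (LinearMap.lcomp R N (F.complex.d (p + 2) (p + 1)).hom) ↔
      T (p + 1) φ ∈ LinearMap.ker
        (LinearMap.lcomp R ω ((F.complex.d (p + 2) (p + 1)).hom.rTensor (N →ₗ[R] ω))) := by
    rw [LinearMap.mem_ker, LinearMap.mem_ker]
    change φ ∘ₗ _ = 0 ↔ T (p + 1) φ ∘ₗ _ = 0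
    rw [← homEquivTensorDual_comp, LinearEquiv.map_eq_zero_iff]
  let τ := (T (p + 1)).toLinearMap.restrict fun φ hφ ↦ (hT φ).mp hφ
  have hτ : Function.Surjective τ := fun ⟨χ, hχ⟩ ↦ by
    obtain ⟨φ, rfl⟩ := (T (p + 1)).surjective χ
    exact ⟨⟨φ, (hT φ).mpr hχ⟩, rfl⟩
  -- Ext and the dual of Tor are both quotients of the cocycles with values in `N`; they agree
  -- because the coboundaries correspond.
  have hker : LinearMap.ker σ = LinearMap.ker (ρ ∘ₗ τ) := by
    ext φ
    rw [LinearMap.mem_ker, LinearMap.mem_ker, LinearMap.comp_apply, hρ0, hσ0]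
    constructor
    · rintro ⟨θ, hθ⟩
      exact ⟨T p θ, (homEquivTensorDual_comp hN θ _).symm.trans (congr_arg (T (p + 1)) hθ)⟩
    · rintro ⟨θ, hθ⟩
      obtain ⟨θ, rfl⟩ := (T p).surjective θ
      exact ⟨θ, (T (p + 1)).injective ((homEquivTensorDual_comp hN θ _).trans hθ)⟩
  exact ⟨((σ.quotKerEquivOfSurjective hσ).symm.trans (Submodule.quotEquivOfEq _ _ hker)).trans
    (((ρ ∘ₗ τ).quotKerEquivOfSurjective (hρ.comp hτ)).trans
      (e.symm.arrowCongr (LinearEquiv.refl R ω)))⟩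

theorem nonempty_ext_equiv (hN : Function.Bijective (bidualEval R N ω))
    (hB : IsExtAcyclic R (N →ₗ[R] ω) ω) {n : ℕ}
    (hTor : ∀ j < n, IsExtAcyclic R (TorMod R j M (N →ₗ[R] ω)) ω) :
    Nonempty (ExtMod R n M N ≃ₗ[R] (TorMod R n M (N →ₗ[R] ω) →ₗ[R] ω)) := by
  cases n with
  | zero => exact nonempty_ext_zero_equiv hN
  | succ p => exact nonempty_ext_succ_equiv hN hB fun j hj ↦ hTor j (by omega)

end Comparison

/-! ### Depth of Tor -/

section DepthLemma

open Abelian RingTheory.Sequence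

variable {R : Type u} [CommRing R] {A B C L : Type u} [AddCommGroup A] [Module R A]
  [AddCommGroup B] [Module R B] [AddCommGroup C] [Module R C] [AddCommGroup L] [Module R L]

theorem ext_lt_subsingleton_left {f : A →ₗ[R] B} {g : B →ₗ[R] C} (hf : Function.Injective f)
    (hg : Function.Surjective g) (h : Function.Exact f g) {d : ℕ}
    (hB : ∀ i < d, Subsingleton (ExtMod R i L B)) (hC : ∀ i < d, Subsingleton (ExtMod R i L C)) :
    ∀ i < d, Subsingleton (ExtMod R i L A) := by
  rintro (_ | i) hi
  · exact ExtMod.subsingleton_zero_left hf (hB 0 hi)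
  · exact ExtMod.subsingleton_left' hf hg h (hC i (by omega)) (hB (i + 1) hi)

theorem depth_tensor [IsLocalRing R] [IsNoetherianRing R] [Module.Flat R A] [Module.Finite R A]
    [Module.Finite R B] {d : ℕ} (hB : ∀ i < d, Subsingleton (ExtMod R i (ResidueField R) B)) :
    ∀ i < d, Subsingleton (ExtMod R i (ResidueField R) (A ⊗[R] B)) := by
  rw [← exists_isWeaklyRegular_iff_ext] at hB ⊢
  obtain ⟨rs, hl, hm, hr⟩ := hB
  exact ⟨rs, hl, hm, hr.isWeaklyRegular_lTensor⟩

/-- The depth of `Tor_{p+1}(M, B)` is maximal if those of `Ω_p ⊗ B`, `Ω_{p+1} ⊗ B` and `B` are. -/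
theorem isMCM_torMod [IsLocalRing R] [IsNoetherianRing R] {M : Type u} [AddCommGroup M]
    [Module R M] {d : ℕ} (hd : ringKrullDim R = d) [Module.Finite R B]
    (hB : ∀ i < d, Subsingleton (ExtMod R i (ResidueField R) B)) {p : ℕ}
    {F : ProjectiveResolution (ModuleCat.of R M)} [Module.Free R (F.complex.X p)]
    [Module.Finite R (F.complex.X p)] (h₀ : IsMCM R (syzygy F p ⊗[R] B))
    (h₁ : IsMCM R (syzygy F (p + 1) ⊗[R] B)) (hTor : Nontrivial (TorMod R (p + 1) M B)) :
    IsMCM R (TorMod R (p + 1) M B) := by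
  have := h₀.finite
  have := h₁.finite
  obtain ⟨e₀⟩ := ProjectiveResolution.nonempty_quotient_equiv F B p
  obtain ⟨e₁⟩ := ProjectiveResolution.nonempty_quotient_equiv F B (p + 1)
  obtain ⟨e⟩ := TorMod.nonempty_succ_equiv F B p
  let h := ProjectiveResolution.rTensor_comp_eq_zero F B (p + 2) (p + 1) p
  have := Module.Finite.equiv e₁.symm
  have := Module.Finite.equiv e.symm
  -- Depth lemma on 0 → im → F_p ⊗ B → Ω_p ⊗ B → 0, and below on 0 → Tor_{p+1} → Ω_{p+1} ⊗ B → im →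
  -- 0.
  have hrange : ∀ i < d, Subsingleton (ExtMod R i (ResidueField R)
      (LinearMap.range (quotientRangeMap h))) := by
    rw [quotientRangeMap_range]
    refine ext_lt_subsingleton_left (Submodule.subtype_injective _) (Submodule.mkQ_surjective _)
      (LinearMap.exact_subtype_mkQ _) (depth_tensor hB) fun i hi ↦ ?_
    exact (ExtMod.subsingleton_congr_right e₀ i).mpr (((isMCM_iff hd).mp h₀).2 i hi)
  refine (isMCM_iff hd).mpr ⟨hTor, fun i hi ↦ (ExtMod.subsingleton_congr_right e i).mpr ?_⟩
  refine ext_lt_subsingleton_left (Submodule.subtype_injective _)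
    (quotientRangeMap h).surjective_rangeRestrict (exact_ker_quotientRangeMap h) (fun i hi ↦ ?_) hrange i hi
  exact (ExtMod.subsingleton_congr_right e₁ i).mpr (((isMCM_iff hd).mp h₁).2 i hi)

end DepthLemma

/-! ### The corollary -/

theorem mainTheorem6 (R : Type u) [CommRing R] [IsLocalRing R] (hR : IsCMLocalRing R)
    (ω : Type u) [AddCommGroup ω] [Module R ω] (hω : IsCanonicalModule R ω)
    (M : Type u) [AddCommGroup M] [Module R M] (hM : Module.Finite R M)
    (N : Type u) [AddCommGroup N] [Module R N] (hN : IsMCM R N)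
    (n : ℕ) (hn : 1 ≤ n)
    (hTor : ∀ j < n, Subsingleton (TorMod R j M (N →ₗ[R] ω)) ∨
      IsMCM R (TorMod R j M (N →ₗ[R] ω))) :
    (Subsingleton (TorMod R n M (N →ₗ[R] ω)) →
      Subsingleton (ExtMod R n M N) ∧
      Nonempty (ExtMod R (n + 1) M N ≃ₗ[R] (TorMod R (n + 1) M (N →ₗ[R] ω) →ₗ[R] ω))) ∧
    (Nontrivial (TorMod R n M (N →ₗ[R] ω)) →
      ∀ F : ProjectiveResolution (ModuleCat.of R M), IsMinimalFreeResolution F →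
      IsMCM R (syzygy F (n - 1) ⊗[R] (N →ₗ[R] ω)) →
      IsMCM R (syzygy F n ⊗[R] (N →ₗ[R] ω)) →
      IsMCM R (TorMod R n M (N →ₗ[R] ω)) ∧
      (∀ j ≤ n + 1,
        Nonempty (ExtMod R j M N ≃ₗ[R] (TorMod R j M (N →ₗ[R] ω) →ₗ[R] ω))) ∧
      Nontrivial (ExtMod R n M N)) := by
  have := hR.noetherian
  have := hω.isMCM.finite
  have := hN.finite
  obtain ⟨d, hd, -⟩ := hω.type_eq_one
  have depthN := ((isMCM_iff hd).mp hN).2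
  have hbid := hω.bidualEval_bijective hR hd depthN
  have depthB := hω.depth_dual hR hd depthN
  have hB : IsExtAcyclic R (N →ₗ[R] ω) ω := hω.ext_succ_subsingleton hR hd depthB
  have mcm {X : Type u} [AddCommGroup X] [Module R X] (h : IsMCM R X) : IsExtAcyclic R X ω :=
    have := h.finite
    hω.ext_succ_subsingleton hR hd ((isMCM_iff hd).mp h).2
  have hacyc (j : ℕ) (hj : j < n) : IsExtAcyclic R (TorMod R j M (N →ₗ[R] ω)) ω :=
    (hTor j hj).elim (fun h ↦ .of_subsingleton) mcm
  obtain ⟨en⟩ := nonempty_ext_equiv hbid hB hacyc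
  have hsucc (h : IsExtAcyclic R (TorMod R n M (N →ₗ[R] ω)) ω) (j : ℕ) (hj : j < n + 1) :
      IsExtAcyclic R (TorMod R j M (N →ₗ[R] ω)) ω := by
    obtain hj | rfl := Nat.lt_succ_iff_lt_or_eq.mp hj
    exacts [hacyc j hj, h]
  refine ⟨fun h0 ↦ ⟨?_, nonempty_ext_equiv hbid hB (hsucc .of_subsingleton)⟩,
    fun hne F hF h₀ h₁ ↦ ?_⟩
  · have : Subsingleton (TorMod R n M (N →ₗ[R] ω) →ₗ[R] ω) := ⟨fun f g ↦ LinearMap.ext fun a ↦ by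
      rw [Subsingleton.elim a 0, map_zero, map_zero]⟩
    exact en.subsingleton
  · obtain ⟨p, rfl⟩ := Nat.exists_eq_add_of_le' hn
    have := hF.free p
    have := hF.finite p
    rw [Nat.add_sub_cancel] at h₀
    have hMCM := isMCM_torMod hd depthB h₀ h₁ hne
    refine ⟨hMCM, fun j hj ↦ nonempty_ext_equiv hbid hB fun i hi ↦
      hsucc (mcm hMCM) i (by omega), ?_⟩
    -- If Ext^n vanished, so would the dual of Tor_n, and then Tor_n itself, which embeds in its
    -- bidual.
    by_contra hE
    rw [not_nontrivial_iff_subsingleton] at hE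
    have hdual := en.symm.subsingleton
    have := hMCM.finite
    have hinj := (hω.bidualEval_bijective hR hd ((isMCM_iff hd).mp hMCM).2).1
    refine not_subsingleton (TorMod R (p + 1) M (N →ₗ[R] ω)) ⟨fun a b ↦ hinj ?_⟩
    exact LinearMap.ext fun f ↦ by rw [hdual.elim f 0, map_zero, map_zero]
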